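/- **Setting.** Let $L\ge 1$, $K\in\{2,3\}$, and let $\Lambda\subset\mathbb R^L$ be a (full-rank) lattice. A symmetric $K$-channel MD-LVQ of type $\Lambda$ consists of the following. * A central lattice $\Lambda_c$ that is geometrically similar to $\Lambda$ (obtained from it by scaling and an orthogonal map), with fundamental volume $\nu$; a sublattice $\Lambda_s\subseteq\Lambda_c$ that is geometrically similar to $\Lambda_c$, of index $N=|\Lambda_c/\Lambda_s|$, with fundamental volume $\nu_s=N\nu$; and a product lattice $\Lambda_\pi\subseteq\Lambda_s$ of index $N^2$ in $\Lambda_c$, with Voronoi cell $V_\pi(0)$ around the origin. Both $\Lambda_s$ and $\Lambda_\pi$ are clean in $\Lambda_c$: no point of $\Lambda_c$ lies on the boundary of one of their Voronoi cells. * The least radius $r\ge 0$ such that for each $\lambda_0\in\Lambda_s\cap V_\pi(0)$ there are at least $N$ distinct $K$-tuples $(\lambda_0,\lambda_1,\dots,\lambda_{K-1})\in\Lambda_s^K$ with first coordinate $\lambda_0$ and $\|\lambda_i-\lambda_j\|\le r$ for all $i,j$. These, for all $\lambda_0\in\Lambda_s\cap V_\pi(0)$, are the constructed $K$-tuples. *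 An injective labeling function $\alpha=(\alpha_0,\dots,\alpha_{K-1}):\Lambda_c\to\Lambda_s^K$ with $\alpha(\lambda_c+\lambda_\pi)=\alpha(\lambda_c)+\lambda_\pi$ for all $\lambda_c\in\Lambda_c$, $\lambda_\pi\in\Lambda_\pi$, such that for each $\lambda_c\in\Lambda_c\cap V_\pi(0)$ some translate of $\alpha(\lambda_c)$ by an element of $\Lambda_\pi$ is a constructed $K$-tuple. Let $\omega_L$ be the volume of the unit ball of $\mathbb R^L$, let $\bar r=\big(\nu_sN^{1/(K-1)}/\omega_L\big)^{1/L}$ be the radius of a ball of volume $\nu_sN^{1/(K-1)}$, and let $$G(S_L)=\frac{1}{L\,\omega_L^{1+2/L}}\int_{\|x\|\le1}\|x\|^2\,dx=\frac{\Gamma(L/2+1)^{2/L}}{(L+2)\pi}$$ be the dimensionless normalized second moment of an $L$-sphere. The high-resolution limit is $N\to\infty$, $\nu_s\to0$ over the quantizers of type $\Lambda$, with $L$ and $\Lambda$ fixed. The dimensionless expansion factor $\psi_L=\psi_{K,L}$ is the high-resolution limit of $r/\bar r$. **Proposition 5.1.** For $K=2$ and $K=3$ the limit $\psi_L$ exists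 and depends only on $K$ and $L$, not on $\Lambda$; for $K=2$ it equals $1$. Consider, for a pair $i\ne j$ in $\{0,\dots,K-1\}$, the ratio $$\rho_{ij}=\frac{\displaystyle\frac1L\sum_{\lambda_c\in\Lambda_c\cap V_\pi(0)}\|\alpha_i(\lambda_c)-\alpha_j(\lambda_c)\|^2}{G(S_L)\,\psi_L^2\,N^2\,N^{2K/(L(K-1))}\,\nu^{2/L}}.$$ 1. For $K=2$ and every $L\ge1$, $\Lambda$ and pair $i\neq j$, $\rho_{ij}\to1$ in the high-resolution limit. 2. For $K=3$, there are real numbers $c_L$ with $c_L\to1$ as $L\to\infty$ such that, for every $L\ge1$, every $\Lambda\subset\mathbb R^L$ and every pair $i\neq j$, $\rho_{ij}\to c_L$ in the high-resolution limit. Thus $\rho_{ij}\to 1$ as $N\to\infty$, $\nu_s\to 0$ and then $L\to\infty$. -/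

import Mathlib

open Filter Topology MeasureTheory

/-- `L`-dimensional Euclidean space. -/
abbrev Euc (L : ℕ) : Type := EuclideanSpace ℝ (Fin L)

/-- The Voronoi cell of the point `s` with respect to the lattice `Λ`. -/
def voronoiCell {L : ℕ} (Λ : Submodule ℤ (Euc L)) (s : Euc L) : Set (Euc L) :=
  {x | ∀ s' ∈ Λ, ‖x - s‖ ^ 2 ≤ ‖x - s'‖ ^ 2}

/-- `Λ'` is geometrically similar to `Λ`: it is obtained from `Λ` by scaling and rotating
(and possibly reflecting). -/
def GeomSimilar {L : ℕ} (Λ Λ' : Submodule ℤ (Euc L)) : Prop :=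
  ∃ c : ℝ, 0 < c ∧ ∃ U : Euc L ≃ₗᵢ[ℝ] Euc L,
    (Λ' : Set (Euc L)) = (fun x => c • U x) '' (Λ : Set (Euc L))

/-- No point of `Λ` lies on the boundary of a Voronoi cell of `Λ'`. -/
def IsClean {L : ℕ} (Λ' Λ : Submodule ℤ (Euc L)) : Prop :=
  ∀ x ∈ Λ, ∀ s ∈ Λ', x ∉ frontier (voronoiCell Λ' s)

/-- The index `|Λ / Λ'|` of a sublattice `Λ'` of `Λ`. -/
noncomputable def latticeIndex {L : ℕ} (Λ' Λ : Submodule ℤ (Euc L)) : ℕ :=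
  Λ'.toAddSubgroup.relIndex Λ.toAddSubgroup

/-- The `K`-tuples of points of `Λ` with first coordinate `lam0` all of whose elements are at
pairwise distance at most `r`; in particular all elements lie in the ball of radius `r`
centred at `lam0`. -/
def kTuples {L : ℕ} (Λ : Submodule ℤ (Euc L)) (K : ℕ) [NeZero K] (r : ℝ) (lam0 : Euc L) :
    Set (Fin K → Euc L) :=
  {t | t 0 = lam0 ∧ (∀ i, t i ∈ Λ) ∧ ∀ i j, ‖t i - t j‖ ≤ r}

/-- A symmetric `K`-channel multiple-description lattice vector quantizer in dimension `L`,
with the sphere-based construction of the `K`-tuples. -/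
structure MDLVQ (K L : ℕ) [NeZero K] where
  /-- the central lattice `Λ_c` -/
  central : Submodule ℤ (Euc L)
  [central_discrete : DiscreteTopology central]
  central_isZLattice : IsZLattice ℝ central
  /-- the sublattice `Λ_s` of the side quantizers -/
  side : Submodule ℤ (Euc L)
  side_le : side ≤ central
  side_similar : GeomSimilar central side
  side_clean : IsClean side central
  /-- the product lattice `Λ_π`; with `N` the index of `Λ_s` in `Λ_c`, each of its Voronoi cells
  contains `N ^ 2` points of `Λ_c` and `N` points of `Λ_s` -/
  prod : Submodule ℤ (Euc L)
  prod_le : prod ≤ side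
  prod_clean : IsClean prod central
  prod_index : latticeIndex prod central = latticeIndex side central ^ 2
  /-- the radius `r` of the sphere that is centred at the points of `Λ_s` -/
  radius : ℝ
  /-- the sphere is just large enough for at least `N` distinct `K`-tuples to be found for each
  first coordinate `lam0` in `Λ_s ∩ V_π(0)` -/
  radius_isLeast : IsLeast {r : ℝ | 0 ≤ r ∧ ∀ lam0 ∈ side, lam0 ∈ voronoiCell prod 0 →
    (latticeIndex side central : ℕ∞) ≤ (kTuples side K r lam0).encard} radius
  /-- the labeling function `α = (α_0, …, α_{K-1})` -/
  label : central → Fin K → side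
  label_injective : Function.Injective label
  /-- shift invariance `α(λ_c + λ_π) = α(λ_c) + λ_π`; together with injectivity it says that the
  points of `Λ_c ∩ V_π(0)` receive tuples from distinct cosets modulo `Λ_π` -/
  label_shift : ∀ (x : central) (p : Euc L) (hp : p ∈ prod) (i : Fin K),
    (label (x + ⟨p, side_le (prod_le hp)⟩) i : Euc L) = (label x i : Euc L) + p
  /-- each point of `Λ_c ∩ V_π(0)` is matched to a member of the coset modulo `Λ_π` of one of the
  constructed tuples -/
  label_matched : ∀ x : central, (x : Euc L) ∈ voronoiCell prod 0 →
    ∃ lam0 ∈ side, lam0 ∈ voronoiCell prod 0 ∧ ∃ p ∈ prod,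
      (fun i => (label x i : Euc L) + p) ∈ kTuples side K radius lam0

/-- The volume of the `L`-dimensional unit ball, `ω_L`. -/
noncomputable def unitBallVolume (L : ℕ) : ℝ :=
  volume.real (Metric.closedBall (0 : Euc L) 1)

/-- The dimensionless normalized second moment of a region of `ℝ^L` (about the origin). -/
noncomputable def normalizedSecondMoment {L : ℕ} (S : Set (Euc L)) : ℝ :=
  1 / (L * volume.real S ^ (1 + 2 / (L : ℝ))) * ∫ x in S, ‖x‖ ^ 2

/-- `G(S_L)`, the normalized second moment of an `L`-sphere (solid ball). -/
noncomputable def sphereSecondMoment (L : ℕ) : ℝ :=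
  normalizedSecondMoment (Metric.closedBall (0 : Euc L) 1)

namespace MDLVQ

variable {K L : ℕ} [NeZero K]

/-- The index `N = |Λ_c / Λ_s|`. -/
noncomputable def index (D : MDLVQ K L) : ℕ := latticeIndex D.side D.central

/-- The volume `ν` of a fundamental region of the central lattice. -/
noncomputable def nu (D : MDLVQ K L) : ℝ := ZLattice.covolume D.central

/-- The volume `ν_s = N ν` of a fundamental region of the sublattice. -/
noncomputable def nuSide (D : MDLVQ K L) : ℝ := D.index * D.nu

/-- The radius of a ball whose volume is `ν_s N^{1/(K-1)}`, the lower bound for the volume of the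
sphere of the construction. -/
noncomputable def lowerRadius (D : MDLVQ K L) : ℝ :=
  (D.nuSide * (D.index : ℝ) ^ (1 / ((K : ℝ) - 1)) / unitBallVolume L) ^ (1 / (L : ℝ))

/-- `(1/L) ∑_{λ_c ∈ V_π(0)} ‖α_i(λ_c) - α_j(λ_c)‖²`, the sum being over the points of the
central lattice in `V_π(0)`. -/
noncomputable def pairDistortion (D : MDLVQ K L) (i j : Fin K) : ℝ :=
  1 / (L : ℝ) * ∑ᶠ x ∈ {x : D.central | (x : Euc L) ∈ voronoiCell D.prod 0},
    ‖(D.label x i : Euc L) - (D.label x j : Euc L)‖ ^ 2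

/-- `G(S_L) ψ² N² N^{2K/(L(K-1))} ν^{2/L}`. -/
noncomputable def sphereExpression (D : MDLVQ K L) (ψ : ℝ) : ℝ :=
  sphereSecondMoment L * ψ ^ 2 * (D.index : ℝ) ^ 2 *
    (D.index : ℝ) ^ (2 * (K : ℝ) / ((L : ℝ) * ((K : ℝ) - 1))) * D.nu ^ (2 / (L : ℝ))

end MDLVQ

/-- The high-resolution limit `N → ∞`, `ν_s → 0` over the `K`-channel quantizers in dimension `L`
whose central lattice is geometrically similar to the given lattice `Λ`. -/
noncomputable def highResolution (K : ℕ) [NeZero K] {L : ℕ} (Λ : Submodule ℤ (Euc L)) : Filter (MDLVQ K L) :=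
  𝓟 {D | GeomSimilar Λ D.central} ⊓ comap MDLVQ.index atTop ⊓ comap MDLVQ.nuSide (𝓝 0)

/-- `ψ` is the dimensionless expansion factor for `K` channels in dimension `L`: whatever the
lattice, it is the high-resolution limit of the ratio between the radius of the sphere that is
needed in order to construct the `K`-tuples and the radius of the sphere that attains the lower
bound. -/
def IsExpansionFactor (K L : ℕ) [NeZero K] (ψ : ℝ) : Prop :=
  ∀ (Λ : Submodule ℤ (Euc L)) [DiscreteTopology Λ] [IsZLattice ℝ Λ],
    Tendsto (fun D : MDLVQ K L => D.radius / D.lowerRadius) (highResolution K Λ) (𝓝 ψ)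

/-! Write `k = K - 1`. By similarity, `Λ_s` is a scaled isometric copy of the fixed lattice `Λ`, so
everything reduces to counting tuples of points of `Λ` in a large dilate of `tupleRegion k L`, the
convex body of tuples `(0, x)` with pairwise distances at most `1`. The count up to radius `R` is
asymptotic to `vol(body) R^(kL) / covol^k`, and the sum of squared distances of entries `i, j` has
the same form with an integral over the body and exponent `kL + 2` (`tendsto_tupleSum`). As `r` is
the least radius with count at least `N`, the count at `r` is itself asymptotic to `N`
(`tendsto_least_radius`). This determines `r`, and `r / r̄` tends to `expansionFactor k L`, in which
the covolume of `Λ` has cancelled.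

The labeling embeds the `N^2` central points of the cell into the pairs (first coordinate, tuple at
the origin). There are `N` times the count of these, hence `N^2 + o(N^2)`, so whichever labeling is
chosen misses only `o(N^2)` pairs, each worth at most `r^2` (`sum_bounds`). The distortion is
therefore governed by the mean `pairMoment` over the body, and the ratio tends to `pairMoment /
ballMoment`.

For `K = 2` the body is the unit ball and the quotient is `1`. For `K = 3` symmetries of the body
make all pairs equivalent, and both moments tend to `1` with `L`, because the mass concentrates near
distance `1` (`volume_tupleRegion_two_inter_le`). -/

variable {L : ℕ}

/-! ### Discreteness, Voronoi cells and sums along injections. -/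

theorem finite_setOf_mem_norm_le (Λ : Submodule ℤ (Euc L)) [DiscreteTopology Λ] (R : ℝ) :
    {x : Euc L | x ∈ Λ ∧ ‖x‖ ≤ R}.Finite := by
  have h := Metric.finite_isBounded_inter_isClosed (K := Metric.closedBall (0 : Euc L) R)
    (s := (Λ : Set (Euc L))) (isDiscrete_iff_discreteTopology.2 ‹_›) Metric.isBounded_closedBall
    (AddSubgroup.isClosed_of_discrete (H := Λ.toAddSubgroup))
  refine h.subset fun x hx => ⟨by simpa using hx.2, hx.1⟩

theorem finite_kTuples (Λ : Submodule ℤ (Euc L)) [DiscreteTopology Λ] (K : ℕ) [NeZero K] (R : ℝ) :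
    (kTuples Λ K R 0).Finite := by
  refine (Set.Finite.pi' fun _ : Fin K => finite_setOf_mem_norm_le Λ R).subset ?_
  rintro t ⟨h0, hm, hd⟩ i
  refine ⟨hm i, ?_⟩
  simpa [h0] using hd i 0

theorem kTuples_mono (Λ : Submodule ℤ (Euc L)) (K : ℕ) [NeZero K] (l : Euc L) {R R' : ℝ}
    (h : R ≤ R') : kTuples Λ K R l ⊆ kTuples Λ K R' l :=
  fun _ ht => ⟨ht.1, ht.2.1, fun i j => (ht.2.2 i j).trans h⟩

theorem exists_sub_mem_voronoiCell (Λ : Submodule ℤ (Euc L)) [DiscreteTopology Λ] (x : Euc L) :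
    ∃ p ∈ Λ, x - p ∈ voronoiCell Λ 0 := by
  -- A lattice point of norm above `2‖x‖` is farther from `x` than `0` is, so a nearest point can be
  -- sought in a finite set.
  have hfin := finite_setOf_mem_norm_le Λ (‖x‖ + ‖x‖)
  obtain ⟨p, hp, hmin⟩ := hfin.exists_minimalFor (fun p => ‖x - p‖) _
    ⟨0, Λ.zero_mem, by simp⟩
  have hmin' : ∀ q ∈ Λ, ‖x - p‖ ≤ ‖x - q‖ := by
    intro q hq
    by_cases hqn : ‖q‖ ≤ ‖x‖ + ‖x‖
    · rcases le_total ‖x - p‖ ‖x - q‖ with h | h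
      · exact h
      · exact hmin ⟨hq, hqn⟩ h
    · have h0 : ‖x - p‖ ≤ ‖x‖ := by
        rcases le_total ‖x - p‖ ‖x - 0‖ with h | h
        · simpa using h
        · simpa using hmin ⟨Λ.zero_mem, by simp⟩ h
      have := norm_sub_norm_le q x
      rw [norm_sub_rev] at this
      linarith
  refine ⟨p, hp.1, fun q hq => ?_⟩
  rw [sub_zero, sub_sub]
  exact pow_le_pow_left₀ (norm_nonneg _) (hmin' _ (Λ.add_mem hp.1 hq)) 2

/-- If `x` and `x - p` are both in the cell and `p ≠ 0`, then `x` is equidistant from `0` and `p`.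
It thus lies on a bounding hyperplane of the cell, which cleanness forbids. -/
theorem eq_of_mem_voronoiCell {Λ M : Submodule ℤ (Euc L)} (hc : IsClean Λ M) {x y : Euc L}
    (hxM : x ∈ M) (hx : x ∈ voronoiCell Λ 0) (hy : y ∈ voronoiCell Λ 0) (h : x - y ∈ Λ) :
    x = y := by
  by_contra hne
  set p := x - y with hp
  have hp0 : 0 < ‖p‖ ^ 2 := by
    have : 0 < ‖p‖ := norm_pos_iff.2 (sub_ne_zero.2 hne)
    positivity
  have h1 := hx p h
  have h2 := hy (-p) (Λ.neg_mem h)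
  have hxp : x - p = y := by simp [hp]
  have hyp : y - -p = x := by simp [hp]
  rw [hxp, sub_zero] at h1
  rw [hyp, sub_zero] at h2
  have heq : ‖x - p‖ ^ 2 = ‖x‖ ^ 2 := by rw [hxp]; exact le_antisymm h2 h1
  rw [norm_sub_sq_real] at heq
  refine hc x hxM 0 Λ.zero_mem ⟨subset_closure hx, fun hint => ?_⟩
  -- Points `(1 + ε) x` with `ε > 0` are strictly closer to `p` than to `0`, so no neighbourhood of
  -- `x` stays in the cell.
  have hcont : Tendsto (fun ε : ℝ => (1 + ε) • x) (𝓝[>] 0) (𝓝 x) := by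
    have : Continuous fun ε : ℝ => (1 + ε) • x := by fun_prop
    have h := this.tendsto 0
    simp only [add_zero, one_smul] at h
    exact h.mono_left nhdsWithin_le_nhds
  have hev := (hcont.eventually (mem_interior_iff_mem_nhds.1 hint)).and self_mem_nhdsWithin
  obtain ⟨ε, hε, hpos⟩ := hev.exists
  have hpos : 0 < ε := hpos
  have h3 := hε p h
  rw [sub_zero, norm_sub_sq_real, real_inner_smul_left] at h3
  nlinarith

theorem ncard_voronoiCell {Λ M : Submodule ℤ (Euc L)} [DiscreteTopology Λ] (hle : Λ ≤ M)
    (hc : IsClean Λ M) : {x : Euc L | x ∈ M ∧ x ∈ voronoiCell Λ 0}.ncard = latticeIndex Λ M := by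
  rw [latticeIndex, AddSubgroup.relIndex, AddSubgroup.index, ← Nat.card_coe_set_eq]
  refine Nat.card_congr (Equiv.ofBijective
    (fun x => (QuotientAddGroup.mk (⟨x.1, x.2.1⟩ : M.toAddSubgroup) :
      M.toAddSubgroup ⧸ (Λ.toAddSubgroup.addSubgroupOf M.toAddSubgroup))) ⟨?_, ?_⟩)
  · rintro ⟨x, hx⟩ ⟨y, hy⟩ hxy
    have := QuotientAddGroup.eq.1 hxy
    have h : -x + y ∈ Λ := this
    refine Subtype.ext (eq_of_mem_voronoiCell hc hx.1 hx.2 hy.2 ?_)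
    have := Λ.neg_mem h
    rwa [neg_add, neg_neg, ← sub_eq_add_neg] at this
  · intro q
    obtain ⟨⟨x, hx⟩, rfl⟩ := QuotientAddGroup.mk_surjective q
    obtain ⟨p, hp, hxp⟩ := exists_sub_mem_voronoiCell Λ x
    refine ⟨⟨x - p, M.sub_mem hx (hle hp), hxp⟩, QuotientAddGroup.eq.2 ?_⟩
    change -(x - p) + x ∈ Λ
    simpa using hp

theorem sum_comp_le_sum_of_injOn {α β : Type*} (X : Finset α) (Y : Finset β) (f : α → β)
    (hf : ∀ x ∈ X, f x ∈ Y) (hinj : Set.InjOn f X) (h : β → ℝ) (h0 : ∀ y ∈ Y, 0 ≤ h y) :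
    ∑ x ∈ X, h (f x) ≤ ∑ y ∈ Y, h y := by
  classical
  rw [← Finset.sum_image (f := h) hinj]
  exact Finset.sum_le_sum_of_subset_of_nonneg (Finset.image_subset_iff.2 hf) fun y hy _ => h0 y hy

/-- The image misses `Y.card - X.card` elements, each worth at most `B`; this is the preceding bound
for `B - h`. -/
theorem sum_sub_le_sum_comp_of_injOn {α β : Type*} (X : Finset α) (Y : Finset β) (f : α → β)
    (hf : ∀ x ∈ X, f x ∈ Y) (hinj : Set.InjOn f X) (h : β → ℝ) {B : ℝ} (hB : ∀ y ∈ Y, h y ≤ B) :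
    ∑ y ∈ Y, h y - (Y.card - X.card) * B ≤ ∑ x ∈ X, h (f x) := by
  have := sum_comp_le_sum_of_injOn X Y f hf hinj (fun y => B - h y)
    fun y hy => sub_nonneg.2 (hB y hy)
  simp only [Finset.sum_sub_distrib, Finset.sum_const, nsmul_eq_mul] at this
  linarith

/-! ### The body of normalized tuples. -/

/-- The tuple with first entry `0` and the given other entries. -/
abbrev consZero {k L : ℕ} (x : Fin k → Euc L) : Fin (k + 1) → Euc L := Fin.cons 0 x

/-- The normalized tuples `(0, x)` with entries at pairwise distance at most `1`. -/
def tupleRegion (k L : ℕ) : Set (Fin k → Euc L) :=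
  {x | ∀ i j, ‖consZero x i - consZero x j‖ ≤ 1}

theorem continuous_consZero {k : ℕ} (i : Fin (k + 1)) :
    Continuous fun x : Fin k → Euc L => consZero x i := by
  refine Fin.cases ?_ (fun j => ?_) i
  · simpa using continuous_const
  · simpa using continuous_apply j

theorem consZero_smul {k : ℕ} (a : ℝ) (x : Fin k → Euc L) : consZero (a • x) = a • consZero x := by
  funext i
  refine Fin.cases ?_ (fun j => ?_) i <;> simp

theorem consZero_add {k : ℕ} (x y : Fin k → Euc L) :
    consZero (x + y) = consZero x + consZero y := by
  funext i
  refine Fin.cases ?_ (fun j => ?_) i <;> simp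

theorem isClosed_tupleRegion (k L : ℕ) : IsClosed (tupleRegion k L) := by
  have : tupleRegion k L = ⋂ i, ⋂ j, {x | ‖consZero x i - consZero x j‖ ≤ 1} := by
    ext x; simp [tupleRegion]
  rw [this]
  exact isClosed_iInter fun i => isClosed_iInter fun j =>
    isClosed_le ((continuous_consZero i).sub (continuous_consZero j)).norm continuous_const

theorem norm_le_one_of_mem_tupleRegion {k : ℕ} {x : Fin k → Euc L} (hx : x ∈ tupleRegion k L)
    (i : Fin k) : ‖x i‖ ≤ 1 := by
  simpa using hx i.succ 0

theorem isBounded_tupleRegion (k L : ℕ) : Bornology.IsBounded (tupleRegion k L) := by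
  refine (Metric.isBounded_closedBall (x := 0) (r := 1)).subset fun x hx => ?_
  rw [mem_closedBall_zero_iff, pi_norm_le_iff_of_nonneg zero_le_one]
  exact norm_le_one_of_mem_tupleRegion hx

theorem isCompact_tupleRegion (k L : ℕ) : IsCompact (tupleRegion k L) :=
  Metric.isCompact_of_isClosed_isBounded (isClosed_tupleRegion k L) (isBounded_tupleRegion k L)

theorem convex_tupleRegion (k L : ℕ) : Convex ℝ (tupleRegion k L) := by
  intro x hx y hy a b ha hb hab i j
  rw [consZero_add, consZero_smul, consZero_smul]
  have : (a • consZero x + b • consZero y) i - (a • consZero x + b • consZero y) j =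
      a • (consZero x i - consZero x j) + b • (consZero y i - consZero y j) := by
    simp only [Pi.add_apply, Pi.smul_apply, smul_sub]; abel
  rw [this]
  calc _ ≤ ‖a • (consZero x i - consZero x j)‖ + ‖b • (consZero y i - consZero y j)‖ :=
        norm_add_le _ _
    _ = a * ‖consZero x i - consZero x j‖ + b * ‖consZero y i - consZero y j‖ := by
        rw [norm_smul, norm_smul, Real.norm_of_nonneg ha, Real.norm_of_nonneg hb]
    _ ≤ a * 1 + b * 1 := by gcongr; exacts [hx i j, hy i j]
    _ = 1 := by linarith

theorem closedBall_half_subset_tupleRegion (k L : ℕ) :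
    Metric.closedBall 0 (1 / 2) ⊆ tupleRegion k L := by
  intro x hx i j
  rw [mem_closedBall_zero_iff, pi_norm_le_iff_of_nonneg (by norm_num)] at hx
  have h : ∀ i, ‖consZero x i‖ ≤ 1 / 2 := fun i => by
    refine Fin.cases ?_ (fun j => ?_) i
    · simp
    · simpa using hx j
  linarith [norm_sub_le (consZero x i) (consZero x j), h i, h j]

theorem volume_tupleRegion_pos (k L : ℕ) : 0 < volume.real (tupleRegion k L) := by
  refine ENNReal.toReal_pos ?_ (isCompact_tupleRegion k L).measure_lt_top.ne
  refine ((Metric.measure_closedBall_pos volume (0 : Fin k → Euc L) (r := 1 / 2)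
    (by norm_num)).trans_le (measure_mono (closedBall_half_subset_tupleRegion k L))).ne'

/-! ### Asymptotic counting of lattice tuples. -/

/-- The coordinates of a tuple of vectors with respect to a basis. -/
noncomputable def tupleCoord {ι : Type*} [Fintype ι] (k : ℕ) (b : Module.Basis ι ℝ (Euc L)) :
    (Fin k × ι → ℝ) ≃L[ℝ] (Fin k → Euc L) :=
  LinearEquiv.toContinuousLinearEquiv
    ((LinearEquiv.curry ℝ ℝ (Fin k) ι).trans
      (LinearEquiv.piCongrRight fun _ => b.equivFun.symm))

theorem tupleCoord_apply {ι : Type*} [Fintype ι] (k : ℕ) (b : Module.Basis ι ℝ (Euc L))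
    (x : Fin k × ι → ℝ) (j : Fin k) : tupleCoord k b x j = b.equivFun.symm fun i => x (j, i) := rfl

/-- The image measure is a Haar measure, so it is a multiple of volume. The factor is read off on
the product of fundamental domains, whose preimage is the unit cube. -/
theorem map_tupleCoord_volume {ι : Type*} [Fintype ι] (k : ℕ) (b : Module.Basis ι ℝ (Euc L)) :
    (volume : Measure (Fin k × ι → ℝ)).map (tupleCoord k b) =
      ((volume (ZSpan.fundamentalDomain b))⁻¹ ^ k) • (volume : Measure (Fin k → Euc L)) := by
  set Φ := tupleCoord k b
  have hhaar : ((volume : Measure (Fin k × ι → ℝ)).map Φ).IsAddHaarMeasure :=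
    Φ.isAddHaarMeasure_map volume
  have hfd := ZSpan.measure_fundamentalDomain_ne_zero b (μ := volume)
  have hfd' : volume (ZSpan.fundamentalDomain b) ≠ ⊤ :=
    (ZSpan.fundamentalDomain_isBounded b).measure_lt_top.ne
  have hmeas : MeasurableSet (Set.univ.pi fun _ : Fin k => ZSpan.fundamentalDomain b) :=
    MeasurableSet.univ_pi fun _ => ZSpan.fundamentalDomain_measurableSet b
  have h1 : (volume : Measure (Fin k × ι → ℝ)).map Φ
      (Set.univ.pi fun _ : Fin k => ZSpan.fundamentalDomain b) = 1 := by
    rw [Measure.map_apply Φ.continuous.measurable hmeas]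
    have : Φ ⁻¹' (Set.univ.pi fun _ : Fin k => ZSpan.fundamentalDomain b) =
        Set.univ.pi fun _ => Set.Ico (0 : ℝ) 1 := by
      ext x
      simp only [Set.mem_preimage, Set.mem_pi, Set.mem_univ, true_imp_iff,
        ZSpan.mem_fundamentalDomain, Prod.forall]
      refine forall_congr' fun j => forall_congr' fun i => ?_
      rw [tupleCoord_apply, ← Module.Basis.equivFun_apply, LinearEquiv.apply_symm_apply]
    rw [this, volume_pi_pi]
    simp
  have h2 : (volume : Measure (Fin k → Euc L))
      (Set.univ.pi fun _ : Fin k => ZSpan.fundamentalDomain b) =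
        volume (ZSpan.fundamentalDomain b) ^ k := by
    rw [volume_pi_pi]; simp
  have h3 := Measure.isAddLeftInvariant_eq_smul ((volume : Measure (Fin k × ι → ℝ)).map Φ)
    (volume : Measure (Fin k → Euc L))
  rw [h3] at h1 ⊢
  rw [Measure.smul_apply, h2, ENNReal.smul_def, smul_eq_mul] at h1
  have := ENNReal.eq_inv_of_mul_eq_one_left h1
  rw [← ENNReal.inv_pow, ← this]
  rfl

open scoped Pointwise in
-- A Riemann sum over the grid `n⁻¹ ℤ^m`. It converges to the integral because the body is bounded
-- and, being convex, has a null frontier.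
theorem tendsto_tsum_tuples {ι : Type*} [Fintype ι] (k : ℕ) (b : Module.Basis ι ℝ (Euc L))
    {g : (Fin k → Euc L) → ℝ} (hg : Continuous g) :
    Tendsto (fun n : ℕ => (∑' x : ↑(tupleCoord k b ⁻¹' tupleRegion k L ∩
        (n : ℝ)⁻¹ • (Submodule.span ℤ (Set.range (Pi.basisFun ℝ (Fin k × ι))) :
          Set (Fin k × ι → ℝ))), g (tupleCoord k b x)) / (n : ℝ) ^ Fintype.card (Fin k × ι))
      atTop (𝓝 ((∫ x in tupleRegion k L, g x) / volume.real (ZSpan.fundamentalDomain b) ^ k)) := by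
  set Φ := tupleCoord k b
  have hconv : Convex ℝ (Φ ⁻¹' tupleRegion k L) :=
    (convex_tupleRegion k L).linear_preimage Φ.toLinearMap
  have hcomp : IsCompact (Φ ⁻¹' tupleRegion k L) :=
    Φ.toHomeomorph.isCompact_preimage.2 (isCompact_tupleRegion k L)
  have hmain := tendsto_tsum_div_pow_atTop_integral (Φ ⁻¹' tupleRegion k L) (F := fun x => g (Φ x))
    (hg.comp Φ.continuous) hcomp.isBounded hcomp.measurableSet (hconv.addHaar_frontier volume)
  convert hmain using 2
  have h := setIntegral_map_equiv (μ := (volume : Measure (Fin k × ι → ℝ)))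
    Φ.toHomeomorph.toMeasurableEquiv g (tupleRegion k L)
  have h' : ∫ x in tupleRegion k L, g x ∂((volume : Measure (Fin k × ι → ℝ)).map Φ) =
    ∫ x in Φ ⁻¹' tupleRegion k L, g (Φ x) := h
  rw [← h', map_tupleCoord_volume, Measure.restrict_smul, integral_smul_measure]
  simp [Measure.real, div_eq_inv_mul]

/-- The sum of `g` over the tuples of points of `Λ` with first entry `0` and all entries at
pairwise distance at most `R`. -/
noncomputable def tupleSum (Λ : Submodule ℤ (Euc L)) (k : ℕ) (g : (Fin (k + 1) → Euc L) → ℝ)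
    (R : ℝ) : ℝ :=
  ∑ᶠ t ∈ kTuples Λ (k + 1) R 0, g t

/-- A function of tuples that is homogeneous of degree `p`. -/
def IsTupleHomogeneous {k : ℕ} (g : (Fin (k + 1) → Euc L) → ℝ) (p : ℕ) : Prop :=
  ∀ (a : ℝ) (t : Fin (k + 1) → Euc L), 0 ≤ a → g (a • t) = a ^ p * g t

theorem tupleCoord_mem_iff {ι : Type*} [Fintype ι] (k : ℕ) (Λ : Submodule ℤ (Euc L))
    [DiscreteTopology Λ] [IsZLattice ℝ Λ] (b : Module.Basis ι ℤ Λ) (z : Fin k × ι → ℝ) :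
    (∀ j, tupleCoord k (b.ofZLatticeBasis ℝ Λ) z j ∈ Λ) ↔
      z ∈ Submodule.span ℤ (Set.range (Pi.basisFun ℝ (Fin k × ι))) := by
  have hΛ : ∀ v : Euc L, v ∈ Λ ↔
      ∀ i, (b.ofZLatticeBasis ℝ Λ).repr v i ∈ Set.range (algebraMap ℤ ℝ) := by
    intro v
    rw [← Module.Basis.mem_span_iff_repr_mem, b.ofZLatticeBasis_span ℝ]
  rw [Module.Basis.mem_span_iff_repr_mem]
  simp only [hΛ, Pi.basisFun_repr, Prod.forall]
  refine forall_congr' fun j => forall_congr' fun i => ?_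
  rw [tupleCoord_apply, ← Module.Basis.equivFun_apply, LinearEquiv.apply_symm_apply]

open scoped Pointwise in
theorem bijOn_tuples {ι : Type*} [Fintype ι] (k : ℕ) (Λ : Submodule ℤ (Euc L))
    [DiscreteTopology Λ] [IsZLattice ℝ Λ] (b : Module.Basis ι ℤ Λ) {n : ℝ} (hn : 0 < n) :
    Set.BijOn (fun x => n • consZero (tupleCoord k (b.ofZLatticeBasis ℝ Λ) x))
      (tupleCoord k (b.ofZLatticeBasis ℝ Λ) ⁻¹' tupleRegion k L ∩
        n⁻¹ • (Submodule.span ℤ (Set.range (Pi.basisFun ℝ (Fin k × ι))) :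
          Set (Fin k × ι → ℝ)))
      (kTuples Λ (k + 1) n 0) := by
  set Φ := tupleCoord k (b.ofZLatticeBasis ℝ Λ) with hΦ
  refine ⟨?_, ?_, ?_⟩
  · rintro x ⟨hxA, hxZ⟩
    rw [Set.mem_inv_smul_set_iff₀ hn.ne', SetLike.mem_coe, ← tupleCoord_mem_iff k Λ b] at hxZ
    refine ⟨by simp, ?_, ?_⟩
    · intro i
      beta_reduce
      rw [← consZero_smul, ← map_smul]
      refine Fin.cases ?_ (fun j => ?_) i
      · simp
      · simpa using hxZ j
    · intro i j
      beta_reduce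
      rw [Pi.smul_apply, Pi.smul_apply, ← smul_sub, norm_smul, Real.norm_of_nonneg hn.le]
      have := hxA i j
      nlinarith
  · intro x _ y _ hxy
    have h1 := smul_right_injective _ hn.ne' hxy
    exact Φ.injective ((Fin.cons_right_injective (α := fun _ => Euc L) 0) h1)
  · rintro t ⟨h0, hm, hd⟩
    have ht : consZero (Fin.tail t) = t := by
      rw [← Fin.cons_self_tail t, h0, Fin.tail_cons]
    have hval : n • consZero (Φ (n⁻¹ • Φ.symm (Fin.tail t))) = t := by
      rw [map_smul, ContinuousLinearEquiv.apply_symm_apply, consZero_smul, ht,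
        smul_inv_smul₀ hn.ne']
    refine ⟨n⁻¹ • Φ.symm (Fin.tail t), ⟨?_, ?_⟩, hval⟩
    · intro i j
      have := hd i j
      rw [map_smul, ContinuousLinearEquiv.apply_symm_apply, consZero_smul, ht,
        Pi.smul_apply, Pi.smul_apply, ← smul_sub, norm_smul, Real.norm_of_nonneg (by positivity)]
      exact inv_mul_le_one_of_le₀ this hn.le
    · refine Set.smul_mem_smul_set ?_
      rw [SetLike.mem_coe, ← tupleCoord_mem_iff k Λ b]
      intro j
      rw [← hΦ, ContinuousLinearEquiv.apply_symm_apply]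
      exact hm j.succ

open scoped Pointwise in
-- Dilation by `n` matches grid points in the body with lattice tuples of radius `n`; homogeneity
-- contributes the factor `n ^ p`.
theorem tendsto_tupleSum_nat (k : ℕ) (Λ : Submodule ℤ (Euc L))
    [DiscreteTopology Λ] [IsZLattice ℝ Λ] {g : (Fin (k + 1) → Euc L) → ℝ} {p : ℕ}
    (hg : Continuous g) (hp : IsTupleHomogeneous g p) :
    Tendsto (fun n : ℕ => tupleSum Λ k g n / (n : ℝ) ^ (k * L + p)) atTop
      (𝓝 ((∫ x in tupleRegion k L, g (consZero x)) / ZLattice.covolume Λ ^ k)) := by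
  classical
  let b := Module.Free.chooseBasis ℤ Λ
  let bR := b.ofZLatticeBasis ℝ Λ
  have hcons : Continuous fun x : Fin k → Euc L => consZero x :=
    continuous_pi fun i => continuous_consZero i
  have hmain := tendsto_tsum_tuples k bR (hg.comp hcons)
  rw [ZLattice.covolume_eq_measure_fundamentalDomain Λ volume
    (ZLattice.isAddFundamentalDomain b volume)]
  refine hmain.congr' ?_
  filter_upwards [eventually_gt_atTop 0] with n hn
  have hn' : (0 : ℝ) < n := Nat.cast_pos.2 hn
  have hbij := bijOn_tuples k Λ b hn'
  have hfin := hbij.finite_iff_finite.2 (finite_kTuples Λ (k + 1) n)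
  have hcard : Fintype.card (Fin k × Module.Free.ChooseBasisIndex ℤ Λ) = k * L := by
    rw [Fintype.card_prod, Fintype.card_fin, ← Module.finrank_eq_card_basis bR]
    simp
  have := hfin.to_subtype
  rw [hcard, tsum_eq_finsum (Set.toFinite _), tupleSum,
    ← finsum_mem_eq_of_bijOn (f := fun x => (n : ℝ) ^ p * g (consZero (tupleCoord k bR x))) _ hbij
      (fun x _ => (hp _ _ hn'.le).symm),
    finsum_set_coe_eq_finsum_mem (f := fun x => (g ∘ fun x => consZero x) (tupleCoord k bR x)),
    ← mul_finsum_mem, pow_add]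
  simp only [Function.comp_apply]
  field_simp
  rfl

theorem tupleSum_mono (Λ : Submodule ℤ (Euc L)) [DiscreteTopology Λ] (k : ℕ)
    {g : (Fin (k + 1) → Euc L) → ℝ} (hg : ∀ t, 0 ≤ g t) : Monotone (tupleSum Λ k g) := by
  intro R R' h
  rw [tupleSum, tupleSum, finsum_mem_eq_finite_toFinset_sum _ (finite_kTuples Λ _ R),
    finsum_mem_eq_finite_toFinset_sum _ (finite_kTuples Λ _ R')]
  refine Finset.sum_le_sum_of_subset_of_nonneg ?_ fun t _ _ => hg t
  simpa using kTuples_mono Λ (k + 1) 0 h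

/-- The growth rate of a monotone function along the naturals is its growth rate along the
reals. -/
theorem Monotone.tendsto_div_pow_atTop {f : ℝ → ℝ} (hf : Monotone f) {d : ℕ} {c : ℝ} (h : Tendsto (fun n : ℕ => f n / (n : ℝ) ^ d) atTop (𝓝 c)) :
    Tendsto (fun x : ℝ => f x / x ^ d) atTop (𝓝 c) := by
  have hl : Tendsto (fun x : ℝ => f ⌊x⌋₊ / (⌊x⌋₊ : ℝ) ^ d * (⌊x⌋₊ / x) ^ d) atTop (𝓝 c) := by
    simpa using (h.comp tendsto_nat_floor_atTop).mul ((tendsto_nat_floor_div_atTop (R := ℝ)).pow d)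
  have hu : Tendsto (fun x : ℝ => f ⌈x⌉₊ / (⌈x⌉₊ : ℝ) ^ d * (⌈x⌉₊ / x) ^ d) atTop (𝓝 c) := by
    simpa using (h.comp tendsto_nat_ceil_atTop).mul ((tendsto_nat_ceil_div_atTop (R := ℝ)).pow d)
  refine tendsto_of_tendsto_of_tendsto_of_le_of_le' hl hu ?_ ?_
  · filter_upwards [eventually_ge_atTop 1] with x hx
    have : 0 < ⌊x⌋₊ := Nat.floor_pos.2 hx
    rw [div_pow, div_mul_div_cancel₀ (by positivity)]
    gcongr
    exact hf (Nat.floor_le (by linarith))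
  · filter_upwards [eventually_ge_atTop 1] with x hx
    have : 0 < ⌈x⌉₊ := Nat.ceil_pos.2 (by linarith)
    rw [div_pow, div_mul_div_cancel₀ (by positivity)]
    gcongr
    exact hf (Nat.le_ceil x)

theorem tendsto_tupleSum (k : ℕ) (Λ : Submodule ℤ (Euc L))
    [DiscreteTopology Λ] [IsZLattice ℝ Λ] {g : (Fin (k + 1) → Euc L) → ℝ} {p : ℕ}
    (hg : Continuous g) (hp : IsTupleHomogeneous g p) (hg0 : ∀ t, 0 ≤ g t) :
    Tendsto (fun R : ℝ => tupleSum Λ k g R / R ^ (k * L + p)) atTop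
      (𝓝 ((∫ x in tupleRegion k L, g (consZero x)) / ZLattice.covolume Λ ^ k)) :=
  (tupleSum_mono Λ k hg0).tendsto_div_pow_atTop (tendsto_tupleSum_nat k Λ hg hp)

/-- The number of tuples of points of `Λ` with first entry `0` and all entries at pairwise distance
at most `R`. -/
noncomputable def tupleCount (Λ : Submodule ℤ (Euc L)) (k : ℕ) (R : ℝ) : ℕ :=
  (kTuples Λ (k + 1) R 0).ncard

theorem tendsto_tupleCount (k : ℕ) (Λ : Submodule ℤ (Euc L)) [DiscreteTopology Λ]
    [IsZLattice ℝ Λ] :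
    Tendsto (fun R : ℝ => (tupleCount Λ k R : ℝ) / R ^ (k * L)) atTop
      (𝓝 (volume.real (tupleRegion k L) / ZLattice.covolume Λ ^ k)) := by
  have h := tendsto_tupleSum k Λ (g := fun _ => 1) (p := 0) continuous_const
    (fun _ _ _ => by simp) fun _ => zero_le_one
  have hcount : ∀ R, tupleSum Λ k (fun _ => 1) R = tupleCount Λ k R := fun R => by
    rw [tupleSum, tupleCount, finsum_mem_eq_finite_toFinset_sum _ (finite_kTuples Λ _ R),
      Set.ncard_eq_toFinset_card _ (finite_kTuples Λ _ R)]
    simp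
  simpa [hcount] using h

theorem tupleCount_mono (Λ : Submodule ℤ (Euc L)) [DiscreteTopology Λ] (k : ℕ) :
    Monotone (tupleCount Λ k) :=
  fun _ R' h => Set.ncard_le_ncard (kTuples_mono Λ (k + 1) 0 h) (finite_kTuples Λ _ R')

/-- If `T R ~ c R ^ d` and `ρ N` is the least radius with `N ≤ T (ρ N)`, then `N ~ c (ρ N) ^ d`. -/
theorem tendsto_least_radius {T : ℝ → ℕ} (hT : Monotone T) {d : ℕ} {c : ℝ}
    (h : Tendsto (fun R => (T R : ℝ) / R ^ d) atTop (𝓝 c)) {α : Type*} {l : Filter α}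
    {N : α → ℕ} (hN : Tendsto N l atTop) {ρ : α → ℝ}
    (hρ : ∀ᶠ a in l, IsLeast {R : ℝ | 0 ≤ R ∧ N a ≤ T R} (ρ a)) :
    Tendsto ρ l atTop ∧ Tendsto (fun a => (N a : ℝ) / ρ a ^ d) l (𝓝 c) := by
  have htop : Tendsto ρ l atTop := by
    refine tendsto_atTop.2 fun R => ?_
    filter_upwards [hρ, hN.eventually_gt_atTop (T R)] with a ha hNa
    by_contra! hlt
    exact absurd (ha.1.2.trans (hT hlt.le)) (not_le.2 hNa)
  refine ⟨htop, ?_⟩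
  -- Minimality gives `T (ρ - 1) < N ≤ T ρ`. Since `(R - 1) / R → 1`, both ends have the same
  -- asymptotics, although `T` may jump at `ρ`.
  have hm1 : Tendsto (fun R : ℝ => R - 1) atTop atTop := tendsto_atTop_add_const_right _ _ tendsto_id
  have hq : Tendsto (fun R : ℝ => (R - 1) / R) atTop (𝓝 1) := by
    have : Tendsto (fun R : ℝ => 1 - R⁻¹) atTop (𝓝 (1 - 0)) :=
      tendsto_const_nhds.sub tendsto_inv_atTop_zero
    rw [sub_zero] at this
    refine this.congr' ?_
    filter_upwards [eventually_gt_atTop 0] with R hR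
    field_simp
  have hl : Tendsto (fun R : ℝ => (T (R - 1) : ℝ) / (R - 1) ^ d * ((R - 1) / R) ^ d) atTop
      (𝓝 c) := by
    simpa using (h.comp hm1).mul (hq.pow d)
  refine tendsto_of_tendsto_of_tendsto_of_le_of_le' (hl.comp htop) (h.comp htop) ?_ ?_
  · filter_upwards [hρ, htop.eventually_gt_atTop 1] with a ha h1
    have h2 : 0 < ρ a - 1 := by linarith
    have h3 : T (ρ a - 1) < N a := by
      by_contra! hle
      linarith [ha.2 ⟨h2.le, hle⟩]
    simp only [Function.comp_apply]
    rw [div_pow, div_mul_div_cancel₀ (by positivity)]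
    gcongr
  · filter_upwards [hρ, htop.eventually_gt_atTop 1] with a ha h1
    simp only [Function.comp_apply]
    gcongr
    exact ha.1.2

/-! ### Behaviour under similarities and translations. -/

theorem GeomSimilar.trans {Λ₁ Λ₂ Λ₃ : Submodule ℤ (Euc L)} (h : GeomSimilar Λ₁ Λ₂)
    (h' : GeomSimilar Λ₂ Λ₃) : GeomSimilar Λ₁ Λ₃ := by
  obtain ⟨c, hc, U, hU⟩ := h
  obtain ⟨c', hc', U', hU'⟩ := h'
  refine ⟨c' * c, mul_pos hc' hc, U.trans U', ?_⟩
  rw [hU', hU, Set.image_image]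
  simp [mul_smul]

/-- Scaling followed by an isometry, as a continuous linear equivalence. -/
noncomputable def similarity (s : ℝ) (hs : s ≠ 0) (U : Euc L ≃ₗᵢ[ℝ] Euc L) :
    Euc L ≃L[ℝ] Euc L :=
  U.toContinuousLinearEquiv.trans (ContinuousLinearEquiv.smulLeft (Units.mk0 s hs))

theorem similarity_apply (s : ℝ) (hs : s ≠ 0) (U : Euc L ≃ₗᵢ[ℝ] Euc L) (x : Euc L) :
    similarity s hs U x = s • U x := rfl

/-- In the form of a `ZLattice.comap`, the similar lattice inherits the instances and the covolume
formula. -/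
theorem eq_comap_similarity {Λ Λ' : Submodule ℤ (Euc L)} {s : ℝ} (hs : s ≠ 0)
    {U : Euc L ≃ₗᵢ[ℝ] Euc L} (h : (Λ' : Set (Euc L)) = (fun x => s • U x) '' (Λ : Set (Euc L))) :
    Λ' = ZLattice.comap ℝ Λ (similarity s hs U).symm.toLinearMap := by
  apply SetLike.coe_injective
  rw [h]
  ext x
  simp only [Set.mem_image, SetLike.mem_coe]
  constructor
  · rintro ⟨y, hy, rfl⟩
    change (similarity s hs U).symm (similarity s hs U y) ∈ Λ
    simpa using hy
  · intro hx
    exact ⟨_, hx, (similarity s hs U).apply_symm_apply x⟩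

theorem GeomSimilar.isZLattice {Λ Λ' : Submodule ℤ (Euc L)} [DiscreteTopology Λ] [IsZLattice ℝ Λ]
    (h : GeomSimilar Λ Λ') : ∃ _ : DiscreteTopology Λ', IsZLattice ℝ Λ' := by
  obtain ⟨s, hs, U, hU⟩ := h
  rw [eq_comap_similarity hs.ne' hU]
  exact ⟨inferInstance, inferInstance⟩

theorem map_similarity_symm_volume {s : ℝ} (hs : 0 < s) (U : Euc L ≃ₗᵢ[ℝ] Euc L) :
    (volume : Measure (Euc L)).map (similarity s hs.ne' U).symm =
      ENNReal.ofReal (s ^ L) • (volume : Measure (Euc L)) := by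
  have h : ((similarity s hs.ne' U).symm : Euc L → Euc L) = U.symm ∘ fun x => s⁻¹ • x := by
    ext1 x
    rw [ContinuousLinearEquiv.symm_apply_eq]
    simp [similarity_apply, hs.ne']
  rw [h, ← Measure.map_map U.symm.continuous.measurable (measurable_const_smul _),
    Measure.map_addHaar_smul _ (inv_ne_zero hs.ne'), Measure.map_smul,
    U.symm.measurePreserving.map_eq]
  simp [abs_of_pos hs]

theorem covolume_smul_measure (Λ : Submodule ℤ (Euc L)) [DiscreteTopology Λ] [IsZLattice ℝ Λ]
    (μ : Measure (Euc L)) [μ.IsAddHaarMeasure] {c : ℝ} (hc : 0 ≤ c)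
    (hμ : μ = ENNReal.ofReal c • (volume : Measure (Euc L))) :
    ZLattice.covolume Λ μ = c * ZLattice.covolume Λ := by
  let b := Module.Free.chooseBasis ℤ Λ
  rw [ZLattice.covolume_eq_measure_fundamentalDomain Λ volume
    (ZLattice.isAddFundamentalDomain b volume), ZLattice.covolume_eq_measure_fundamentalDomain Λ μ
    (ZLattice.isAddFundamentalDomain b μ), hμ, measureReal_ennreal_smul_apply,
    ENNReal.toReal_ofReal hc]

theorem covolume_eq_of_similar {Λ Λ' : Submodule ℤ (Euc L)} [DiscreteTopology Λ] [IsZLattice ℝ Λ]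
    {s : ℝ} (hs : 0 < s) {U : Euc L ≃ₗᵢ[ℝ] Euc L}
    (h : (Λ' : Set (Euc L)) = (fun x => s • U x) '' (Λ : Set (Euc L))) :
    ZLattice.covolume Λ' = s ^ L * ZLattice.covolume Λ := by
  have := (similarity s hs.ne' U).symm.isAddHaarMeasure_map volume
  rw [eq_comap_similarity hs.ne' h, ZLattice.covolume_comap Λ
    ((volume : Measure (Euc L)).map (similarity s hs.ne' U).symm) volume
    ⟨(similarity s hs.ne' U).symm.continuous.measurable, rfl⟩,
    covolume_smul_measure Λ _ (by positivity) (map_similarity_symm_volume hs U)]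

theorem bijOn_kTuples_similar {Λ Λ' : Submodule ℤ (Euc L)} {s : ℝ} (hs : 0 < s)
    {U : Euc L ≃ₗᵢ[ℝ] Euc L} (h : (Λ' : Set (Euc L)) = (fun x => s • U x) '' (Λ : Set (Euc L)))
    (K : ℕ) [NeZero K] (R : ℝ) :
    Set.BijOn (fun (t : Fin K → Euc L) i => s • U (t i)) (kTuples Λ K R 0)
      (kTuples Λ' K (s * R) 0) := by
  have hmem : ∀ y, y ∈ Λ' ↔ ∃ x ∈ Λ, s • U x = y := fun y => by
    rw [← SetLike.mem_coe, h]; rfl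
  have hnorm : ∀ x y, ‖s • U x - s • U y‖ = s * ‖x - y‖ := fun x y => by
    rw [← smul_sub, ← map_sub, norm_smul, Real.norm_of_nonneg hs.le, LinearIsometryEquiv.norm_map]
  refine ⟨?_, ?_, ?_⟩
  · rintro t ⟨h0, hm, hd⟩
    refine ⟨by simp [h0], fun i => (hmem _).2 ⟨_, hm i, rfl⟩, fun i j => ?_⟩
    rw [hnorm]
    exact mul_le_mul_of_nonneg_left (hd i j) hs.le
  · intro t _ t' _ htt
    funext i
    exact U.injective (smul_right_injective _ hs.ne' (congrFun htt i))
  · rintro t ⟨h0, hm, hd⟩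
    choose u hu hut using fun i => (hmem _).1 (hm i)
    refine ⟨u, ⟨?_, hu, fun i j => ?_⟩, funext hut⟩
    · have := hut 0
      rw [h0] at this
      simpa [hs.ne'] using this
    · have := hd i j
      rw [← hut i, ← hut j, hnorm] at this
      exact le_of_mul_le_mul_left this hs

theorem tupleCount_similar {Λ Λ' : Submodule ℤ (Euc L)} {s : ℝ} (hs : 0 < s)
    {U : Euc L ≃ₗᵢ[ℝ] Euc L} (h : (Λ' : Set (Euc L)) = (fun x => s • U x) '' (Λ : Set (Euc L)))
    (k : ℕ) (R : ℝ) : tupleCount Λ' k (s * R) = tupleCount Λ k R := by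
  have hb := bijOn_kTuples_similar hs h (k + 1) R
  rw [tupleCount, tupleCount, ← hb.image_eq, Set.InjOn.ncard_image hb.injOn]

/-- The squared distance of two entries of a tuple. -/
noncomputable def pairDist {K : ℕ} (i j : Fin K) (t : Fin K → Euc L) : ℝ := ‖t i - t j‖ ^ 2

theorem continuous_pairDist {K : ℕ} (i j : Fin K) : Continuous (pairDist (L := L) i j) := by
  unfold pairDist; fun_prop

theorem pairDist_nonneg {K : ℕ} (i j : Fin K) (t : Fin K → Euc L) : 0 ≤ pairDist i j t := by
  unfold pairDist; positivity

theorem isTupleHomogeneous_pairDist {k : ℕ} (i j : Fin (k + 1)) :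
    IsTupleHomogeneous (pairDist (L := L) i j) 2 := by
  intro a t ha
  rw [pairDist, pairDist, Pi.smul_apply, Pi.smul_apply, ← smul_sub, norm_smul, mul_pow,
    Real.norm_of_nonneg ha]

theorem tupleSum_pairDist_similar {Λ Λ' : Submodule ℤ (Euc L)} {s : ℝ} (hs : 0 < s)
    {U : Euc L ≃ₗᵢ[ℝ] Euc L} (h : (Λ' : Set (Euc L)) = (fun x => s • U x) '' (Λ : Set (Euc L)))
    (k : ℕ) (i j : Fin (k + 1)) (R : ℝ) :
    tupleSum Λ' k (pairDist i j) (s * R) = s ^ 2 * tupleSum Λ k (pairDist i j) R := by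
  rw [tupleSum, tupleSum, mul_finsum_mem]
  refine (finsum_mem_eq_of_bijOn _ (bijOn_kTuples_similar hs h (k + 1) R) fun t _ => ?_).symm
  rw [pairDist, pairDist, ← smul_sub, ← map_sub, norm_smul, Real.norm_of_nonneg hs.le,
    LinearIsometryEquiv.norm_map, mul_pow]

theorem encard_kTuples_translate {Λ : Submodule ℤ (Euc L)} (K : ℕ) [NeZero K] (R : ℝ)
    {l : Euc L} (hl : l ∈ Λ) : (kTuples Λ K R l).encard = (kTuples Λ K R 0).encard := by
  have : kTuples Λ K R l = (fun (t : Fin K → Euc L) i => t i + l) '' kTuples Λ K R 0 := by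
    ext t
    constructor
    · rintro ⟨h0, hm, hd⟩
      exact ⟨fun i => t i - l, ⟨by simp [h0], fun i => Λ.sub_mem (hm i) hl, by simpa using hd⟩,
        by simp⟩
    · rintro ⟨u, ⟨h0, hm, hd⟩, rfl⟩
      exact ⟨by simp [h0], fun i => Λ.add_mem (hm i) hl, by simpa using hd⟩
  rw [this, Function.Injective.encard_image]
  intro t t' h
  funext i
  exact add_right_cancel (congrFun h i)

/-! ### Combinatorics of a single quantizer. -/

namespace MDLVQ

variable {k : ℕ}

theorem discreteTopology_of_le (D : MDLVQ (k + 1) L) {M : Submodule ℤ (Euc L)}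
    (h : M ≤ D.central) : DiscreteTopology M :=
  DiscreteTopology.of_subset D.central_discrete h

/-- By translation invariance all first coordinates impose the same condition, and `0` is one of
those in the cell. -/
theorem isLeast_radius (D : MDLVQ (k + 1) L) :
    IsLeast {r : ℝ | 0 ≤ r ∧ D.index ≤ tupleCount D.side k r} D.radius := by
  have := D.discreteTopology_of_le D.side_le
  convert D.radius_isLeast using 1
  ext r
  refine and_congr_right fun _ => ?_
  have hiff : D.index ≤ tupleCount D.side k r ↔
      (latticeIndex D.side D.central : ℕ∞) ≤ (kTuples D.side (k + 1) r 0).encard := by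
    rw [tupleCount, ← (finite_kTuples D.side (k + 1) r).cast_ncard_eq, Nat.cast_le]; rfl
  rw [hiff]
  refine ⟨fun h l hl _ => by rwa [encard_kTuples_translate _ _ hl], fun h => h 0 D.side.zero_mem ?_⟩
  intro p _
  simp

theorem ncard_central (D : MDLVQ (k + 1) L) :
    {x : D.central | (x : Euc L) ∈ voronoiCell D.prod 0}.ncard = D.index ^ 2 := by
  have := D.discreteTopology_of_le (D.prod_le.trans D.side_le)
  rw [← Set.ncard_image_of_injective _ Subtype.val_injective, index, ← D.prod_index,
    ← ncard_voronoiCell (D.prod_le.trans D.side_le) D.prod_clean]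
  congr 1
  ext x
  simp [and_comm]

/-- Multiplicativity of the index: `|Λ_s / Λ_π| * N = N^2`. -/
theorem ncard_side (D : MDLVQ (k + 1) L) (hN : D.index ≠ 0) :
    {x : Euc L | x ∈ D.side ∧ x ∈ voronoiCell D.prod 0}.ncard = D.index := by
  have := D.discreteTopology_of_le (D.prod_le.trans D.side_le)
  rw [ncard_voronoiCell D.prod_le fun x hx => D.prod_clean x (D.side_le hx)]
  have h : latticeIndex D.prod D.side * latticeIndex D.side D.central =
      latticeIndex D.prod D.central :=
    AddSubgroup.relIndex_mul_relIndex _ _ _ D.prod_le D.side_le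
  rw [D.prod_index, sq] at h
  exact Nat.eq_of_mul_eq_mul_right (Nat.pos_of_ne_zero hN) h

/-- A point of the central lattice in the cell of the product lattice determines a constructed
tuple: its first entry, and the tuple translated to the origin. -/
theorem exists_tuple (D : MDLVQ (k + 1) L) :
    ∃ f : D.central → Euc L × (Fin (k + 1) → Euc L),
      Set.InjOn f {x : D.central | (x : Euc L) ∈ voronoiCell D.prod 0} ∧
      ∀ x : D.central, (x : Euc L) ∈ voronoiCell D.prod 0 →
        (((f x).1 ∈ D.side ∧ (f x).1 ∈ voronoiCell D.prod 0) ∧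
          (f x).2 ∈ kTuples D.side (k + 1) D.radius 0) ∧
        ∀ i j, pairDist i j (f x).2 = ‖(D.label x i : Euc L) - (D.label x j : Euc L)‖ ^ 2 := by
  classical
  choose l hl hlV p hp ht using D.label_matched
  refine ⟨fun x => if h : (x : Euc L) ∈ voronoiCell D.prod 0 then
    (l x h, fun i => (D.label x i : Euc L) + p x h - l x h) else 0, ?_, ?_⟩
  · intro x hx y hy hxy
    have hx' : (x : Euc L) ∈ voronoiCell D.prod 0 := hx
    have hy' : (y : Euc L) ∈ voronoiCell D.prod 0 := hy
    simp only [dif_pos hx', dif_pos hy', Prod.mk.injEq] at hxy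
    obtain ⟨h1, h2⟩ := hxy
    rw [h1] at h2
    -- Equal pairs mean equal labels after translation by `p x` and `p y`. Shift invariance and
    -- injectivity then put `x` and `y` in one coset of `Λ_π`, where the cell has only one central
    -- point.
    have h3 : x + ⟨p x hx', D.side_le (D.prod_le (hp x hx'))⟩ =
        y + ⟨p y hy', D.side_le (D.prod_le (hp y hy'))⟩ := by
      apply D.label_injective
      funext i
      apply Subtype.ext
      rw [D.label_shift _ _ (hp x hx'), D.label_shift _ _ (hp y hy')]
      exact sub_left_injective (congrFun h2 i)
    have h4 : (x : Euc L) + p x hx' = y + p y hy' := congrArg Subtype.val h3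
    refine Subtype.ext (eq_of_mem_voronoiCell D.prod_clean x.2 hx' hy' ?_)
    have h5 : (x : Euc L) - y = p y hy' - p x hx' := by
      rw [sub_eq_sub_iff_add_eq_add, h4, add_comm]
    rw [h5]
    exact D.prod.sub_mem (hp y hy') (hp x hx')
  · intro x hx
    simp only [dif_pos hx]
    obtain ⟨h0, hm, hd⟩ := ht x hx
    refine ⟨⟨⟨hl x hx, hlV x hx⟩, by simpa [sub_eq_zero] using h0,
      fun i => D.side.sub_mem (hm i) (hl x hx), fun i j => by simpa using hd i j⟩, fun i j => ?_⟩
    simp [pairDist]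

/-- The central points occupy `N^2` of the `N * tupleCount` available pairs, and a missed pair
contributes at most `r^2`. Only injectivity matters, not which tuples the labeling selects. -/
theorem sum_bounds (D : MDLVQ (k + 1) L) (hL : 0 < L) (hN : D.index ≠ 0) (i j : Fin (k + 1)) :
    D.index * tupleSum D.side k (pairDist i j) D.radius -
        (D.index * tupleCount D.side k D.radius - (D.index : ℝ) ^ 2) * D.radius ^ 2 ≤
      L * D.pairDistortion i j ∧
    L * D.pairDistortion i j ≤ D.index * tupleSum D.side k (pairDist i j) D.radius := by
  classical
  have := D.discreteTopology_of_le D.side_le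
  obtain ⟨f, hinj, hf⟩ := D.exists_tuple
  set X := {x : D.central | (x : Euc L) ∈ voronoiCell D.prod 0} with hX
  set Q := {x : Euc L | x ∈ D.side ∧ x ∈ voronoiCell D.prod 0} with hQ
  have hXc : X.ncard = D.index ^ 2 := D.ncard_central
  have hQc : Q.ncard = D.index := D.ncard_side hN
  have hXf : X.Finite := Set.finite_of_ncard_ne_zero (by rw [hXc]; positivity)
  have hQf : Q.Finite := Set.finite_of_ncard_ne_zero (by rw [hQc]; exact hN)
  have hTf := finite_kTuples D.side (k + 1) D.radius
  rw [Set.ncard_eq_toFinset_card _ hXf] at hXc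
  rw [Set.ncard_eq_toFinset_card _ hQf] at hQc
  have hsum : L * D.pairDistortion i j = ∑ x ∈ hXf.toFinset, pairDist i j (f x).2 := by
    rw [pairDistortion, ← mul_assoc, mul_one_div_cancel (by positivity), one_mul,
      finsum_mem_eq_finite_toFinset_sum _ hXf]
    refine Finset.sum_congr rfl fun x hx => ?_
    exact ((hf x (hXf.mem_toFinset.1 hx)).2 i j).symm
  have hprod : ∑ y ∈ hQf.toFinset ×ˢ hTf.toFinset, pairDist i j y.2 =
      D.index * tupleSum D.side k (pairDist i j) D.radius := by
    rw [Finset.sum_product, tupleSum, finsum_mem_eq_finite_toFinset_sum _ hTf]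
    simp [hQc]
  have hcard : (hQf.toFinset ×ˢ hTf.toFinset).card = D.index * tupleCount D.side k D.radius := by
    rw [Finset.card_product, hQc, tupleCount, Set.ncard_eq_toFinset_card _ hTf]
  have hmaps : ∀ x ∈ hXf.toFinset, f x ∈ hQf.toFinset ×ˢ hTf.toFinset := by
    intro x hx
    have := (hf x (hXf.mem_toFinset.1 hx)).1
    exact Finset.mem_product.2 ⟨hQf.mem_toFinset.2 this.1, hTf.mem_toFinset.2 this.2⟩
  have hinj' : Set.InjOn f hXf.toFinset := by simpa using hinj
  rw [hsum, ← hprod]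
  constructor
  · have h := sum_sub_le_sum_comp_of_injOn hXf.toFinset (hQf.toFinset ×ˢ hTf.toFinset) f hmaps
      hinj' (fun y => pairDist i j y.2) (B := D.radius ^ 2) ?_
    · rw [hcard, hXc] at h
      push_cast at h
      exact h
    · rintro ⟨q, t⟩ hy
      have ht : t ∈ kTuples D.side (k + 1) D.radius 0 := by
        simpa using (Finset.mem_product.1 hy).2
      exact pow_le_pow_left₀ (norm_nonneg _) (ht.2.2 i j) 2
  · exact sum_comp_le_sum_of_injOn hXf.toFinset (hQf.toFinset ×ˢ hTf.toFinset) f hmaps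
      hinj' (fun y => pairDist i j y.2) fun y _ => pairDist_nonneg _ _ _

theorem nuSide_eq_covolume (D : MDLVQ (k + 1) L) : D.nuSide = ZLattice.covolume D.side := by
  have := D.central_discrete
  have := D.central_isZLattice
  obtain ⟨_, _⟩ := D.side_similar.isZLattice
  have h := ZLattice.covolume_div_covolume_eq_relIndex' D.side D.central D.side_le
  rw [nuSide, nu, index, latticeIndex, ← h,
    div_mul_cancel₀ _ (ZLattice.covolume_ne_zero D.central volume)]

theorem nu_pos (D : MDLVQ (k + 1) L) : 0 < D.nu := by
  have := D.central_discrete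
  have := D.central_isZLattice
  exact ZLattice.covolume_pos D.central volume

end MDLVQ

/-! ### High-resolution limits in fixed dimension. -/

theorem unitBallVolume_pos (L : ℕ) : 0 < unitBallVolume L :=
  ENNReal.toReal_pos (Metric.measure_closedBall_pos volume _ one_pos).ne'
    measure_closedBall_lt_top.ne

/-- The mean squared norm over the unit ball. -/
noncomputable def ballMoment (L : ℕ) : ℝ :=
  (∫ x in Metric.closedBall (0 : Euc L) 1, ‖x‖ ^ 2) / unitBallVolume L

/-- The mean squared distance of two entries of the normalized tuples. -/
noncomputable def pairMoment {k : ℕ} (L : ℕ) (i j : Fin (k + 1)) : ℝ :=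
  (∫ x in tupleRegion k L, pairDist i j (consZero x)) / volume.real (tupleRegion k L)

/-- The high-resolution limit of the ratio between the radius of the construction and its lower
bound, for `k + 1` channels. -/
noncomputable def expansionFactor (k L : ℕ) : ℝ :=
  ((volume.real (tupleRegion k L) ^ (1 / (k : ℝ)) / unitBallVolume L) ^ (1 / (L : ℝ)))⁻¹

theorem expansionFactor_pos (k L : ℕ) : 0 < expansionFactor k L := by
  have := volume_tupleRegion_pos k L
  have := unitBallVolume_pos L
  unfold expansionFactor
  positivity

namespace MDLVQ

variable {k : ℕ}

/-- The scale of the side lattice relative to `Λ`. -/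
noncomputable def scale (Λ : Submodule ℤ (Euc L)) (D : MDLVQ (k + 1) L) : ℝ :=
  (D.nuSide / ZLattice.covolume Λ) ^ (1 / (L : ℝ))

/-- The covolumes determine the similarity ratio, so it is a definite function of the quantizer and
limits involving it make sense. -/
theorem exists_side_eq (Λ : Submodule ℤ (Euc L)) [DiscreteTopology Λ] [IsZLattice ℝ Λ]
    (hL : 0 < L) (D : MDLVQ (k + 1) L) (hD : GeomSimilar Λ D.central) :
    0 < D.scale Λ ∧ D.scale Λ ^ L * ZLattice.covolume Λ = D.nuSide ∧ ∃ U : Euc L ≃ₗᵢ[ℝ] Euc L,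
      (D.side : Set (Euc L)) = (fun x => D.scale Λ • U x) '' (Λ : Set (Euc L)) := by
  obtain ⟨s, hs, U, hU⟩ := hD.trans D.side_similar
  have hcov := covolume_eq_of_similar hs hU
  have h : D.scale Λ = s := by
    rw [scale, nuSide_eq_covolume, hcov, mul_div_assoc,
      div_self (ZLattice.covolume_ne_zero Λ volume), mul_one, one_div,
      Real.pow_rpow_inv_natCast hs.le hL.ne']
  rw [h, nuSide_eq_covolume]
  exact ⟨hs, hcov.symm, U, hU⟩

theorem tendsto_index (k : ℕ) (Λ : Submodule ℤ (Euc L)) :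
    Tendsto (fun D : MDLVQ (k + 1) L => D.index) (highResolution (k + 1) Λ) atTop :=
  tendsto_comap.mono_left (inf_le_left.trans inf_le_right)

theorem eventually_similar (k : ℕ) (Λ : Submodule ℤ (Euc L)) :
    ∀ᶠ D : MDLVQ (k + 1) L in highResolution (k + 1) Λ, GeomSimilar Λ D.central :=
  (inf_le_left.trans inf_le_left : highResolution (k + 1) Λ ≤ _) (mem_principal_self _)

/-- Rescaling replaces the varying lattice `Λ_s` by the fixed `Λ`, to which the counting asymptotics
apply. -/
theorem isLeast_radius_div_scale (Λ : Submodule ℤ (Euc L)) [DiscreteTopology Λ] [IsZLattice ℝ Λ]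
    (hL : 0 < L) (D : MDLVQ (k + 1) L) (hD : GeomSimilar Λ D.central) :
    IsLeast {R : ℝ | 0 ≤ R ∧ D.index ≤ tupleCount Λ k R} (D.radius / D.scale Λ) := by
  obtain ⟨hs, -, U, hU⟩ := D.exists_side_eq Λ hL hD
  have hr := D.isLeast_radius
  constructor
  · refine ⟨div_nonneg hr.1.1 hs.le, ?_⟩
    rw [← tupleCount_similar hs hU, mul_div_cancel₀ _ hs.ne']
    exact hr.1.2
  · rintro R ⟨hR, hN⟩
    rw [← tupleCount_similar hs hU] at hN
    rw [div_le_iff₀' hs]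
    exact hr.2 ⟨mul_nonneg hs.le hR, hN⟩

theorem tendsto_radius_div_scale (hL : 0 < L) (k : ℕ) (Λ : Submodule ℤ (Euc L))
    [DiscreteTopology Λ] [IsZLattice ℝ Λ] :
    Tendsto (fun D : MDLVQ (k + 1) L => D.radius / D.scale Λ) (highResolution (k + 1) Λ) atTop ∧
    Tendsto (fun D : MDLVQ (k + 1) L => (D.index : ℝ) / (D.radius / D.scale Λ) ^ (k * L))
      (highResolution (k + 1) Λ)
      (𝓝 (volume.real (tupleRegion k L) / ZLattice.covolume Λ ^ k)) :=
  tendsto_least_radius (tupleCount_mono Λ k) (tendsto_tupleCount k Λ) (tendsto_index k Λ)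
    ((eventually_similar k Λ).mono fun D hD => D.isLeast_radius_div_scale Λ hL hD)

/-- Expresses `r̄ / r` through the single quantity `N / (r / scale)^(kL)`, whose limit is known. -/
theorem lowerRadius_eq (Λ : Submodule ℤ (Euc L)) [DiscreteTopology Λ] [IsZLattice ℝ Λ]
    (hL : 0 < L) (hk : 0 < k) (D : MDLVQ (k + 1) L) (hD : GeomSimilar Λ D.central)
    (hr : 0 < D.radius) :
    D.lowerRadius = (ZLattice.covolume Λ * ((D.index : ℝ) /
      (D.radius / D.scale Λ) ^ (k * L)) ^ (1 / (k : ℝ)) / unitBallVolume L) ^ (1 / (L : ℝ)) *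
        D.radius := by
  obtain ⟨hs, hcov, -⟩ := D.exists_side_eq Λ hL hD
  have hω := unitBallVolume_pos L
  have hc := ZLattice.covolume_pos Λ volume
  have hX : ∀ X : ℝ, 0 ≤ X → X ^ (1 / (L : ℝ)) * D.radius = (X * D.radius ^ L) ^ (1 / (L : ℝ)) := by
    intro X hX
    rw [Real.mul_rpow hX (by positivity), one_div, Real.pow_rpow_inv_natCast hr.le hL.ne']
  have hk' : ((D.radius / D.scale Λ) ^ (k * L)) ^ (1 / (k : ℝ)) =
      (D.radius / D.scale Λ) ^ L := by
    rw [mul_comm, pow_mul, one_div, Real.pow_rpow_inv_natCast (by positivity) hk.ne']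
  rw [lowerRadius, Real.div_rpow (Nat.cast_nonneg _) (by positivity), hk', hX _ (by positivity),
    ← hcov]
  congr 1
  have : ((k + 1 : ℕ) : ℝ) - 1 = k := by push_cast; ring
  rw [this, div_pow]
  field_simp

theorem tendsto_radius_div_lowerRadius (hL : 0 < L) {k : ℕ} (hk : 0 < k)
    (Λ : Submodule ℤ (Euc L)) [DiscreteTopology Λ] [IsZLattice ℝ Λ] :
    Tendsto (fun D : MDLVQ (k + 1) L => D.radius / D.lowerRadius) (highResolution (k + 1) Λ)
      (𝓝 (expansionFactor k L)) := by
  obtain ⟨htop, hlim⟩ := tendsto_radius_div_scale hL k Λ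
  have hω := unitBallVolume_pos L
  have hc := ZLattice.covolume_pos Λ volume
  have hB := volume_tupleRegion_pos k L
  -- The covolume cancels here, which is why the expansion factor does not depend on `Λ`.
  have hval : ZLattice.covolume Λ * (volume.real (tupleRegion k L) /
      ZLattice.covolume Λ ^ k) ^ (1 / (k : ℝ)) = volume.real (tupleRegion k L) ^ (1 / (k : ℝ)) := by
    rw [Real.div_rpow (by positivity) (by positivity), one_div,
      Real.pow_rpow_inv_natCast hc.le hk.ne', mul_div_cancel₀ _ hc.ne']
  have h1 := ((((hlim.rpow_const (p := 1 / (k : ℝ)) (Or.inl (by positivity))).const_mul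
    (ZLattice.covolume Λ)).div_const (unitBallVolume L)).rpow_const (p := 1 / (L : ℝ))
      (Or.inl (by positivity))).inv₀ (by positivity)
  rw [hval] at h1
  refine h1.congr' ?_
  filter_upwards [eventually_similar k Λ, htop.eventually_gt_atTop 0] with D hD hr
  have hr' : 0 < D.radius := by
    have := (D.exists_side_eq Λ hL hD).1
    rwa [div_pos_iff_of_pos_right this] at hr
  rw [D.lowerRadius_eq Λ hL hk hD hr', div_mul_cancel_right₀ hr'.ne']

theorem tendsto_pairDistortion_div_radius (hL : 0 < L) (k : ℕ)
    (Λ : Submodule ℤ (Euc L)) [DiscreteTopology Λ] [IsZLattice ℝ Λ] (i j : Fin (k + 1)) :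
    Tendsto (fun D : MDLVQ (k + 1) L => L * D.pairDistortion i j /
      ((D.index : ℝ) ^ 2 * D.radius ^ 2)) (highResolution (k + 1) Λ) (𝓝 (pairMoment L i j)) := by
  obtain ⟨htop, hlim⟩ := tendsto_radius_div_scale hL k Λ
  have hc := ZLattice.covolume_pos Λ volume
  have hB := volume_tupleRegion_pos k L
  have hb : volume.real (tupleRegion k L) / ZLattice.covolume Λ ^ k ≠ 0 := by positivity
  have hS := ((tendsto_tupleSum k Λ (continuous_pairDist i j) (isTupleHomogeneous_pairDist i j)
    (pairDist_nonneg i j)).comp htop).div hlim hb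
  have hT := ((tendsto_tupleCount k Λ).comp htop).div hlim hb
  rw [div_self hb] at hT
  rw [div_div_div_cancel_right₀ (by positivity)] at hS
  -- The lower bound falls short of the upper one by `tupleCount / N - 1`, which tends to `0`.
  have hl := hS.sub (hT.sub_const 1)
  rw [sub_self, sub_zero] at hl
  refine tendsto_of_tendsto_of_tendsto_of_le_of_le' hl hS ?_ ?_
  all_goals
    filter_upwards [eventually_similar k Λ, htop.eventually_gt_atTop 0,
      (tendsto_index k Λ).eventually_gt_atTop 0] with D hD hr hN
    obtain ⟨hs, -, U, hU⟩ := D.exists_side_eq Λ hL hD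
    have hr' : 0 < D.radius := by rwa [div_pos_iff_of_pos_right hs] at hr
    have hN' : (0 : ℝ) < D.index := Nat.cast_pos.2 hN
    obtain ⟨h1, h2⟩ := D.sum_bounds hL hN.ne' i j
    have e : D.radius = D.scale Λ * (D.radius / D.scale Λ) := (mul_div_cancel₀ _ hs.ne').symm
    have hS' := tupleSum_pairDist_similar hs hU k i j (D.radius / D.scale Λ)
    have hT' := tupleCount_similar hs hU k (D.radius / D.scale Λ)
    rw [← e] at hS' hT'
    rw [hS'] at h1 h2
    rw [hT'] at h1
    set ρ := D.radius / D.scale Λ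
    simp only [Function.comp_apply, Pi.div_apply]
    rw [pow_add]
  · rw [le_div_iff₀ (by positivity)]
    refine le_trans (le_of_eq ?_) h1
    rw [e]
    field_simp
  · rw [div_le_iff₀ (by positivity)]
    refine h2.trans (le_of_eq ?_)
    rw [e]
    field_simp

/-- The exponents agree because `(1 + 1/k) (2/L) = 2K / (L k)`, and `L G(S_L)` is `ballMoment L`
divided by `ω_L^(2/L)`. -/
theorem mul_sphereExpression (hL : 0 < L) (hk : 0 < k) (D : MDLVQ (k + 1) L) (hN : 0 < D.index)
    (ψ : ℝ) : L * D.sphereExpression ψ =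
      ballMoment L * ψ ^ 2 * ((D.index : ℝ) ^ 2 * D.lowerRadius ^ 2) := by
  have hω := unitBallVolume_pos L
  have hν := D.nu_pos
  have hN' : (0 : ℝ) < D.index := Nat.cast_pos.2 hN
  have hL' : (0 : ℝ) < L := Nat.cast_pos.2 hL
  have hk' : (0 : ℝ) < k := Nat.cast_pos.2 hk
  have hcast : ((k + 1 : ℕ) : ℝ) - 1 = k := by push_cast; ring
  have hlr : D.lowerRadius ^ 2 = (D.index : ℝ) ^ (2 * ((k + 1 : ℕ) : ℝ) / ((L : ℝ) * k)) *
      D.nu ^ (2 / (L : ℝ)) / unitBallVolume L ^ (2 / (L : ℝ)) := by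
    have e1 : (D.index : ℝ) * D.nu * (D.index : ℝ) ^ (1 / (k : ℝ)) =
        (D.index : ℝ) ^ (1 + 1 / (k : ℝ)) * D.nu := by
      rw [Real.rpow_add hN', Real.rpow_one]; ring
    rw [lowerRadius, nuSide, hcast, e1, ← Real.rpow_natCast, ← Real.rpow_mul (by positivity),
      Real.div_rpow (by positivity) hω.le, Real.mul_rpow (by positivity) hν.le,
      ← Real.rpow_mul hN'.le]
    have e2 : 1 / (L : ℝ) * ((2 : ℕ) : ℝ) = 2 / L := by push_cast; ring
    have e3 : (1 + 1 / (k : ℝ)) * (2 / L) = 2 * ((k + 1 : ℕ) : ℝ) / (L * k) := by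
      push_cast; field_simp
    rw [e2, e3]
  rw [hlr, sphereExpression, hcast, sphereSecondMoment, normalizedSecondMoment, ballMoment,
    ← unitBallVolume, Real.rpow_add hω, Real.rpow_one]
  field_simp

theorem tendsto_pairDistortion_div_sphereExpression (hL : 0 < L) {k : ℕ} (hk : 0 < k)
    (Λ : Submodule ℤ (Euc L)) [DiscreteTopology Λ] [IsZLattice ℝ Λ] (i j : Fin (k + 1)) :
    Tendsto (fun D : MDLVQ (k + 1) L =>
        D.pairDistortion i j / D.sphereExpression (expansionFactor k L))
      (highResolution (k + 1) Λ) (𝓝 (pairMoment L i j / ballMoment L)) := by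
  have hψ := expansionFactor_pos k L
  have h := ((tendsto_pairDistortion_div_radius hL k Λ i j).mul
    (((tendsto_radius_div_lowerRadius hL hk Λ).div_const (expansionFactor k L)).pow 2)).div_const
    (ballMoment L)
  rw [div_self hψ.ne', one_pow, mul_one] at h
  refine h.congr' ?_
  filter_upwards [eventually_similar k Λ, (tendsto_radius_div_scale hL k Λ).1.eventually_gt_atTop 0,
    (tendsto_index k Λ).eventually_gt_atTop 0] with D hD hr hN
  have hs := (D.exists_side_eq Λ hL hD).1
  have hr' : 0 < D.radius := by rwa [div_pos_iff_of_pos_right hs] at hr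
  have hL' : (0 : ℝ) < L := Nat.cast_pos.2 hL
  rw [← mul_div_mul_left (D.pairDistortion i j) _ hL'.ne', D.mul_sphereExpression hL hk hN]
  field_simp

end MDLVQ

/-! ### Two channels, and the symmetry between pairs for three. -/

theorem mem_tupleRegion_one {x : Fin 1 → Euc L} : x ∈ tupleRegion 1 L ↔ ‖x 0‖ ≤ 1 := by
  refine ⟨fun h => norm_le_one_of_mem_tupleRegion h 0, fun h => ?_⟩
  have h1 : consZero x 1 = x 0 := rfl
  intro i j
  fin_cases i <;> fin_cases j <;> simp [h1, h]

theorem mem_tupleRegion_two {x : Fin 2 → Euc L} :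
    x ∈ tupleRegion 2 L ↔ ‖x 0‖ ≤ 1 ∧ ‖x 1‖ ≤ 1 ∧ ‖x 0 - x 1‖ ≤ 1 := by
  have h1 : consZero x 1 = x 0 := rfl
  have h2 : consZero x 2 = x 1 := rfl
  constructor
  · intro h
    have h12 := h 1 2
    rw [h1, h2] at h12
    exact ⟨norm_le_one_of_mem_tupleRegion h 0, norm_le_one_of_mem_tupleRegion h 1, h12⟩
  · rintro ⟨ha, hb, hab⟩ i j
    have hba : ‖x 1 - x 0‖ ≤ 1 := by rwa [norm_sub_rev]
    fin_cases i <;> fin_cases j <;> simp [h1, h2, ha, hb, hab, hba]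

theorem tupleRegion_one_eq_preimage (L : ℕ) :
    tupleRegion 1 L = MeasurableEquiv.funUnique (Fin 1) (Euc L) ⁻¹' Metric.closedBall 0 1 := by
  ext x
  rw [mem_tupleRegion_one, Set.mem_preimage, mem_closedBall_zero_iff]
  rfl

theorem volume_tupleRegion_one (L : ℕ) : volume.real (tupleRegion 1 L) = unitBallVolume L := by
  have h := (volume_preserving_funUnique (Fin 1) (Euc L)).measureReal_preimage
    (Metric.isClosed_closedBall (x := (0 : Euc L)) (ε := 1)).measurableSet.nullMeasurableSet
  rw [tupleRegion_one_eq_preimage, unitBallVolume, ← h]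
  rfl

theorem expansionFactor_one (L : ℕ) : expansionFactor 1 L = 1 := by
  rw [expansionFactor, volume_tupleRegion_one, Nat.cast_one, div_one, Real.rpow_one,
    div_self (unitBallVolume_pos L).ne', Real.one_rpow, inv_one]

theorem pairDist_comm {K : ℕ} (i j : Fin K) (t : Fin K → Euc L) :
    pairDist i j t = pairDist j i t := by
  rw [pairDist, pairDist, norm_sub_rev]

theorem pairMoment_comm {k : ℕ} (L : ℕ) (i j : Fin (k + 1)) :
    pairMoment L i j = pairMoment L j i := by
  simp_rw [pairMoment, pairDist_comm i j]

theorem pairDist_zero_succ {k : ℕ} (i : Fin k) (x : Fin k → Euc L) :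
    pairDist 0 i.succ (consZero x) = ‖x i‖ ^ 2 := by
  simp [pairDist]

theorem pairMoment_two_channels (L : ℕ) {i j : Fin 2} (hij : i ≠ j) :
    pairMoment L i j = ballMoment L := by
  have h01 : pairMoment L (0 : Fin 2) 1 = ballMoment L := by
    have h := (volume_preserving_funUnique (Fin 1) (Euc L)).setIntegral_preimage_emb
      (MeasurableEquiv.measurableEmbedding _) (fun x => ‖x‖ ^ 2) (Metric.closedBall 0 1)
    rw [pairMoment, volume_tupleRegion_one, ballMoment, ← h, tupleRegion_one_eq_preimage]
    congr 2
    funext x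
    exact pairDist_zero_succ 0 x
  fin_cases i <;> fin_cases j
  · exact absurd rfl hij
  · exact h01
  · exact (pairMoment_comm L 1 0).trans h01
  · exact absurd rfl hij

theorem LinearMap.abs_det_eq_one_of_involutive {V : Type*} [AddCommGroup V] [Module ℝ V]
    (f : V →ₗ[ℝ] V) (hf : ∀ x, f (f x) = x) : |LinearMap.det f| = 1 := by
  have h : LinearMap.det (f ∘ₗ f) = 1 := by
    rw [show f ∘ₗ f = LinearMap.id from LinearMap.ext hf, LinearMap.det_id]
  rw [LinearMap.det_comp] at h
  have h2 : |LinearMap.det f| * |LinearMap.det f| = 1 := by rw [← abs_mul, h, abs_one]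
  nlinarith [abs_nonneg (LinearMap.det f)]

/-- A linear involution has determinant `±1`, so it preserves Haar measure. -/
theorem setIntegral_comp_involution {V : Type*} [NormedAddCommGroup V] [NormedSpace ℝ V]
    [FiniteDimensional ℝ V] [MeasurableSpace V] [BorelSpace V] (μ : Measure V) [μ.IsAddHaarMeasure]
    (f : V →ₗ[ℝ] V) (hf : ∀ x, f (f x) = x) {s : Set V} (hs : ∀ x ∈ s, f x ∈ s) (g : V → ℝ) :
    ∫ x in s, g (f x) ∂μ = ∫ x in s, g x ∂μ := by
  have hdet := LinearMap.abs_det_eq_one_of_involutive f hf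
  have hne : LinearMap.det f ≠ 0 := fun h => by simp [h] at hdet
  have hcont : Continuous f := f.continuous_of_finiteDimensional
  have hmp : MeasurePreserving f μ μ := by
    refine ⟨hcont.measurable, ?_⟩
    rw [Measure.map_linearMap_addHaar_eq_smul_addHaar μ hne, abs_inv, hdet]
    simp
  let e : V ≃ᵐ V := Homeomorph.toMeasurableEquiv ⟨⟨f, f, hf, hf⟩, hcont, hcont⟩
  have hpre : f ⁻¹' s = s :=
    Set.Subset.antisymm (fun x hx => by simpa [hf] using hs _ hx) fun x hx => hs x hx
  have := hmp.setIntegral_preimage_emb e.measurableEmbedding g s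
  rwa [hpre] at this

/-- The involution `(x, y) ↦ (x, c x - y)`. -/
noncomputable def reflectSnd (L : ℕ) (c : ℝ) : (Fin 2 → Euc L) →ₗ[ℝ] (Fin 2 → Euc L) :=
  LinearMap.pi ![LinearMap.proj 0, c • LinearMap.proj 0 - LinearMap.proj 1]

/-- The involution `(x, y) ↦ (y, x)`. -/
noncomputable def swapPair (L : ℕ) : (Fin 2 → Euc L) →ₗ[ℝ] (Fin 2 → Euc L) :=
  LinearMap.pi ![LinearMap.proj 1, LinearMap.proj 0]

@[simp] theorem reflectSnd_zero (c : ℝ) (x : Fin 2 → Euc L) : reflectSnd L c x 0 = x 0 := rfl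

@[simp] theorem reflectSnd_one (c : ℝ) (x : Fin 2 → Euc L) :
    reflectSnd L c x 1 = c • x 0 - x 1 := rfl

@[simp] theorem swapPair_zero (x : Fin 2 → Euc L) : swapPair L x 0 = x 1 := rfl

@[simp] theorem swapPair_one (x : Fin 2 → Euc L) : swapPair L x 1 = x 0 := rfl

theorem reflectSnd_reflectSnd (c : ℝ) (x : Fin 2 → Euc L) :
    reflectSnd L c (reflectSnd L c x) = x := by
  funext i
  fin_cases i <;> simp

theorem swapPair_swapPair (x : Fin 2 → Euc L) : swapPair L (swapPair L x) = x := by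
  funext i
  fin_cases i <;> simp

theorem pairMoment_three_channels (L : ℕ) {i j : Fin 3} (hij : i ≠ j) :
    pairMoment L i j = pairMoment L (0 : Fin 3) 1 := by
  have h02 : pairMoment L (0 : Fin 3) 2 = pairMoment L (0 : Fin 3) 1 := by
    have h := setIntegral_comp_involution volume (swapPair L) swapPair_swapPair
      (s := tupleRegion 2 L) (fun x hx => by
        rw [mem_tupleRegion_two] at hx ⊢
        simpa [norm_sub_rev] using ⟨hx.2.1, hx.1, hx.2.2⟩) (fun x => ‖x 0‖ ^ 2)
    rw [pairMoment, pairMoment]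
    congr 1
    refine Eq.trans ?_ (h.trans ?_) <;> congr 1 <;> funext x
    · exact pairDist_zero_succ 1 x
    · exact (pairDist_zero_succ 0 x).symm
  -- The map `(x, y) ↦ (x, x - y)` exchanges the lengths `‖y‖` and `‖x - y‖` and so preserves the
  -- body.
  have h12 : pairMoment L (1 : Fin 3) 2 = pairMoment L (0 : Fin 3) 2 := by
    have h := setIntegral_comp_involution volume (reflectSnd L 1) (reflectSnd_reflectSnd 1)
      (s := tupleRegion 2 L) (fun x hx => by
        rw [mem_tupleRegion_two] at hx ⊢
        simpa using ⟨hx.1, hx.2.2, hx.2.1⟩) (fun x => ‖x 1‖ ^ 2)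
    rw [pairMoment, pairMoment]
    congr 1
    refine Eq.trans ?_ (h.trans ?_) <;> congr 1 <;> funext x
    · have h1 : consZero x 1 = x 0 := rfl
      have h2 : consZero x 2 = x 1 := rfl
      rw [pairDist, h1, h2]
      simp
    · exact (pairDist_zero_succ 1 x).symm
  fin_cases i <;> fin_cases j
  · exact absurd rfl hij
  · rfl
  · exact h02
  · exact pairMoment_comm L 1 0
  · exact absurd rfl hij
  · exact h12.trans h02
  · exact (pairMoment_comm L 2 0).trans h02
  · exact (pairMoment_comm L 2 1).trans (h12.trans h02)
  · exact absurd rfl hij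

/-! ### Concentration as the dimension grows. -/

/-- If only a small part of a compact set lies where the continuous function `q` with values in
`[0, 1]` is below `a`, then the mean of `q ^ 2` is near `1`. -/
theorem mean_sq_bounds {V : Type*} [TopologicalSpace V] [T2Space V] [MeasurableSpace V]
    [BorelSpace V] (μ : Measure V) [IsFiniteMeasureOnCompacts μ] {A : Set V} (hA : IsCompact A)
    (hpos : 0 < μ.real A) {q : V → ℝ} (hq : Continuous q) (hq0 : ∀ x, 0 ≤ q x)
    (hq1 : ∀ x ∈ A, q x ≤ 1) {a θ : ℝ} (ha : 0 ≤ a)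
    (hθ : μ.real (A ∩ {x | q x ≤ a}) ≤ θ * μ.real A) :
    a ^ 2 * (1 - θ) ≤ (∫ x in A, q x ^ 2 ∂μ) / μ.real A ∧
      (∫ x in A, q x ^ 2 ∂μ) / μ.real A ≤ 1 := by
  have hfin : μ A ≠ ⊤ := hA.measure_lt_top.ne
  have hint : IntegrableOn (fun x => q x ^ 2) A μ := (hq.pow 2).continuousOn.integrableOn_compact hA
  have hmeas : MeasurableSet {x | q x ≤ a} := (isClosed_le hq continuous_const).measurableSet
  rw [le_div_iff₀ hpos, div_le_one hpos]
  constructor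
  · have hsplit := measureReal_inter_add_sdiff (μ := μ) (s := A) hmeas hfin
    have hdm : MeasurableSet (A \ {x | q x ≤ a}) := hA.measurableSet.diff hmeas
    have h1 : ∫ x in A \ {x | q x ≤ a}, q x ^ 2 ∂μ ≤ ∫ x in A, q x ^ 2 ∂μ :=
      setIntegral_mono_set hint (Eventually.of_forall fun x => by positivity)
        (Set.sdiff_subset.eventuallyLE)
    have h2 : a ^ 2 * μ.real (A \ {x | q x ≤ a}) ≤ ∫ x in A \ {x | q x ≤ a}, q x ^ 2 ∂μ := by
      have := setIntegral_mono_on (μ := μ) (s := A \ {x | q x ≤ a}) (f := fun _ => a ^ 2)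
        (g := fun x => q x ^ 2)
        (integrableOn_const (measure_ne_top_of_subset Set.sdiff_subset hfin))
        (hint.mono_set Set.sdiff_subset) hdm fun x hx =>
          pow_le_pow_left₀ ha (not_le.1 hx.2).le 2
      simpa [mul_comm] using this
    have h3 : (1 - θ) * μ.real A ≤ μ.real (A \ {x | q x ≤ a}) := by linarith
    nlinarith [sq_nonneg a]
  · have := setIntegral_mono_on (μ := μ) (s := A) (f := fun x => q x ^ 2) (g := fun _ => (1 : ℝ))
      hint (integrableOn_const hfin) hA.measurableSet fun x hx => pow_le_one₀ (hq0 x) (hq1 x hx)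
    simpa using this

/-- For a target below `1`, `a` is fixed with `a^2` above it; then `n` is taken large enough to make
`θ a ^ n` negligible. -/
theorem tendsto_one_of_geometric_bounds {m : ℕ → ℝ} (θ : ℝ → ℝ)
    (hθ : ∀ a, 0 < a → a < 1 → 0 ≤ θ a ∧ θ a < 1)
    (hm : ∀ a, 0 < a → a < 1 → ∀ n, a ^ 2 * (1 - θ a ^ n) ≤ m n) (hm1 : ∀ n, m n ≤ 1) :
    Tendsto m atTop (𝓝 1) := by
  refine tendsto_order.2 ⟨fun b hb => ?_, fun b hb => Eventually.of_forall fun n =>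
    (hm1 n).trans_lt hb⟩
  obtain ⟨a, ha0, ha1, hab⟩ : ∃ a : ℝ, 0 < a ∧ a < 1 ∧ b < a ^ 2 := by
    have hc : Tendsto (fun a : ℝ => a ^ 2) (𝓝[<] 1) (𝓝 (1 ^ 2)) :=
      ((continuous_pow 2).tendsto 1).mono_left nhdsWithin_le_nhds
    rw [one_pow] at hc
    obtain ⟨a, h1, h2⟩ := ((hc.eventually (lt_mem_nhds hb)).and
      (Ioo_mem_nhdsLT (zero_lt_one' ℝ))).exists
    exact ⟨a, h2.1, h2.2, h1⟩
  obtain ⟨h0, h1⟩ := hθ a ha0 ha1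
  have hl : Tendsto (fun n => a ^ 2 * (1 - θ a ^ n)) atTop (𝓝 (a ^ 2 * (1 - 0))) :=
    ((tendsto_pow_atTop_nhds_zero_of_lt_one h0 h1).const_sub 1).const_mul _
  rw [sub_zero, mul_one] at hl
  filter_upwards [hl.eventually (lt_mem_nhds hab)] with n hn
  exact hn.trans_le (hm a ha0 ha1 n)

theorem ballMoment_bounds (L : ℕ) {a : ℝ} (ha0 : 0 < a) (ha1 : a < 1) :
    a ^ 2 * (1 - a ^ L) ≤ ballMoment L ∧ ballMoment L ≤ 1 := by
  refine mean_sq_bounds volume (isCompact_closedBall (0 : Euc L) 1) (unitBallVolume_pos L)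
    continuous_norm (fun x => norm_nonneg x) (fun x hx => by simpa using hx) ha0.le ?_
  have : Metric.closedBall (0 : Euc L) 1 ∩ {x | ‖x‖ ≤ a} = Metric.closedBall 0 a := by
    ext x
    simp only [Set.mem_inter_iff, mem_closedBall_zero_iff, Set.mem_ofPred_eq]
    exact ⟨fun h => h.2, fun h => ⟨h.trans ha1.le, h⟩⟩
  rw [this, Measure.addHaar_real_closedBall' volume _ ha0.le]
  simp

theorem ballMoment_pos (hL : 0 < L) : 0 < ballMoment L := by
  refine lt_of_lt_of_le ?_ (ballMoment_bounds L (a := 1 / 2) (by norm_num) (by norm_num)).1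
  have : (1 / 2 : ℝ) ^ L < 1 := pow_lt_one₀ (by norm_num) (by norm_num) hL.ne'
  nlinarith

/-- The map `(x, y) ↦ (a x, b y)`. -/
noncomputable def scalePair (L : ℕ) (a b : ℝ) : (Fin 2 → Euc L) →ₗ[ℝ] (Fin 2 → Euc L) :=
  LinearMap.pi fun i => ((![a, b] i) • LinearMap.id).comp (LinearMap.proj i)

theorem det_scalePair (L : ℕ) (a b : ℝ) : LinearMap.det (scalePair L a b) = (a * b) ^ L := by
  rw [scalePair, LinearMap.det_pi]
  simp [LinearMap.det_smul, mul_pow]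

/-- In the coordinates `x` and `y - x / 2`, scaling by `1 / a` and `1 / (2 - a)` maps the part
`‖x‖ ≤ a` of the tuple region into the tuple region. -/
theorem volume_tupleRegion_two_inter_le (L : ℕ) {a : ℝ} (ha0 : 0 < a) (ha1 : a < 1) :
    volume.real (tupleRegion 2 L ∩ {x | ‖x 0‖ ≤ a}) ≤
      (a * (2 - a)) ^ L * volume.real (tupleRegion 2 L) := by
  have h2a : 0 < 2 - a := by linarith
  -- Conjugating by the reflection makes the scaling act on `x` and `y - x/2`, so the edges `y` and
  -- `x - y` are treated alike.
  set f := reflectSnd L (1 / 2) ∘ₗ scalePair L a⁻¹ (2 - a)⁻¹ ∘ₗ reflectSnd L (1 / 2) with hf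
  have hdet : |LinearMap.det f| = ((a * (2 - a)) ^ L)⁻¹ := by
    rw [hf, LinearMap.det_comp, LinearMap.det_comp, abs_mul, abs_mul,
      LinearMap.abs_det_eq_one_of_involutive _ (reflectSnd_reflectSnd (1 / 2)), one_mul, mul_one,
      det_scalePair, ← mul_inv, inv_pow, abs_of_pos (by positivity)]
  have hcoef : 0 ≤ a⁻¹ / 2 - (2 - a)⁻¹ / 2 := by
    have : (2 - a)⁻¹ ≤ a⁻¹ := inv_anti₀ ha0 (by linarith)
    linarith
  -- This identity dictates the factor `2 - a`: the triangle inequality then keeps both remaining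
  -- edges at length at most `1`.
  have hone : (2 - a)⁻¹ + (a⁻¹ / 2 - (2 - a)⁻¹ / 2) * a = 1 := by
    field_simp
    ring
  have hbound : ∀ v w : Euc L, ‖v‖ ≤ 1 → ‖w‖ ≤ a →
      ‖(2 - a)⁻¹ • v + (a⁻¹ / 2 - (2 - a)⁻¹ / 2) • w‖ ≤ 1 := by
    intro v w hv hw
    refine (norm_add_le _ _).trans ?_
    rw [norm_smul, norm_smul, Real.norm_of_nonneg (by positivity), Real.norm_of_nonneg hcoef,
      ← hone]
    have h1 : (2 - a)⁻¹ * ‖v‖ ≤ (2 - a)⁻¹ := mul_le_of_le_one_right (by positivity) hv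
    have h2 := mul_le_mul_of_nonneg_left hw hcoef
    linarith
  have hsub : f '' (tupleRegion 2 L ∩ {x | ‖x 0‖ ≤ a}) ⊆ tupleRegion 2 L := by
    rintro _ ⟨x, ⟨hx, hxa⟩, rfl⟩
    rw [mem_tupleRegion_two] at hx ⊢
    have hxa : ‖x 0‖ ≤ a := hxa
    have hf0 : f x 0 = a⁻¹ • x 0 := rfl
    have hf1 : f x 1 = (2 - a)⁻¹ • x 1 + (a⁻¹ / 2 - (2 - a)⁻¹ / 2) • x 0 := by
      have : f x 1 = (1 / 2 : ℝ) • a⁻¹ • x 0 - (2 - a)⁻¹ • ((1 / 2 : ℝ) • x 0 - x 1) := rfl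
      rw [this]
      module
    have hf2 : f x 0 - f x 1 = (2 - a)⁻¹ • (x 0 - x 1) + (a⁻¹ / 2 - (2 - a)⁻¹ / 2) • x 0 := by
      rw [hf0, hf1]
      module
    refine ⟨?_, ?_, ?_⟩
    · rw [hf0, norm_smul, Real.norm_of_nonneg (by positivity)]
      exact inv_mul_le_one_of_le₀ hxa ha0.le
    · rw [hf1]
      exact hbound _ _ hx.2.1 hxa
    · rw [hf2]
      exact hbound _ _ hx.2.2 hxa
  have hle := measureReal_mono (μ := volume) hsub (isCompact_tupleRegion 2 L).measure_lt_top.ne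
  rw [measureReal_def, Measure.addHaar_image_linearMap, hdet, ENNReal.toReal_mul,
    ENNReal.toReal_ofReal (by positivity), ← measureReal_def] at hle
  rwa [inv_mul_le_iff₀ (by positivity)] at hle

theorem pairMoment_three_bounds (L : ℕ) {a : ℝ} (ha0 : 0 < a) (ha1 : a < 1) :
    a ^ 2 * (1 - (a * (2 - a)) ^ L) ≤ pairMoment L (0 : Fin 3) 1 ∧
      pairMoment L (0 : Fin 3) 1 ≤ 1 := by
  have h := mean_sq_bounds volume (isCompact_tupleRegion 2 L) (volume_tupleRegion_pos 2 L)
    (q := fun x => ‖x 0‖) (by fun_prop) (fun x => norm_nonneg _)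
    (fun x hx => norm_le_one_of_mem_tupleRegion hx 0) ha0.le
    (volume_tupleRegion_two_inter_le L ha0 ha1)
  have he : pairMoment L (0 : Fin 3) 1 =
      (∫ x in tupleRegion 2 L, ‖x 0‖ ^ 2) / volume.real (tupleRegion 2 L) := by
    rw [pairMoment]
    congr 2
    funext x
    exact pairDist_zero_succ 0 x
  rwa [he]

theorem tendsto_ballMoment : Tendsto ballMoment atTop (𝓝 1) :=
  tendsto_one_of_geometric_bounds (fun a => a) (fun _ h0 h1 => ⟨h0.le, h1⟩)
    (fun _ h0 h1 L => (ballMoment_bounds L h0 h1).1)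
    fun L => (ballMoment_bounds L (a := 1 / 2) (by norm_num) (by norm_num)).2

theorem tendsto_pairMoment_three :
    Tendsto (fun L => pairMoment L (0 : Fin 3) 1) atTop (𝓝 1) :=
  tendsto_one_of_geometric_bounds (fun a => a * (2 - a))
    -- The rate is below `1` since `a (2 - a) = 1 - (1 - a)^2`.
    (fun a h0 h1 => ⟨mul_nonneg h0.le (by linarith), by nlinarith [sq_nonneg (1 - a)]⟩)
    (fun _ h0 h1 L => (pairMoment_three_bounds L h0 h1).1)
    fun L => (pairMoment_three_bounds L (a := 1 / 2) (by norm_num) (by norm_num)).2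

theorem proposition5p1 :
    -- `K = 2`, in every fixed dimension `L`; the expansion factor is `1`
    (∀ L : ℕ, 0 < L → IsExpansionFactor 2 L 1 ∧
      ∀ (Λ : Submodule ℤ (Euc L)) [DiscreteTopology Λ] [IsZLattice ℝ Λ] (i j : Fin 2), i ≠ j →
        Tendsto (fun D : MDLVQ 2 L => D.pairDistortion i j / D.sphereExpression 1)
          (highResolution 2 Λ) (𝓝 1)) ∧
    -- `K = 3`: the limit for fixed `L`, followed by the limit `L → ∞`
    (∃ ψ : ℕ → ℝ, (∀ L : ℕ, 0 < L → IsExpansionFactor 3 L (ψ L)) ∧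
      ∃ c : ℕ → ℝ, Tendsto c atTop (𝓝 1) ∧
        ∀ L : ℕ, 0 < L →
          ∀ (Λ : Submodule ℤ (Euc L)) [DiscreteTopology Λ] [IsZLattice ℝ Λ] (i j : Fin 3), i ≠ j →
            Tendsto (fun D : MDLVQ 3 L => D.pairDistortion i j / D.sphereExpression (ψ L))
              (highResolution 3 Λ) (𝓝 (c L))) := by
  refine ⟨fun L hL => ⟨fun Λ _ _ => ?_, fun Λ _ _ i j hij => ?_⟩, expansionFactor 2,
    fun L hL Λ _ _ => MDLVQ.tendsto_radius_div_lowerRadius hL two_pos Λ,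
    fun L => pairMoment L (0 : Fin 3) 1 / ballMoment L, ?_, fun L hL Λ _ _ i j hij => ?_⟩
  · have h := MDLVQ.tendsto_radius_div_lowerRadius hL one_pos Λ
    rw [expansionFactor_one] at h
    exact h
  · have h := MDLVQ.tendsto_pairDistortion_div_sphereExpression hL one_pos Λ i j
    rw [expansionFactor_one, pairMoment_two_channels L hij, div_self (ballMoment_pos hL).ne'] at h
    exact h
  · have h := tendsto_pairMoment_three.div tendsto_ballMoment one_ne_zero
    rw [div_one] at h
    exact h
  · have h := MDLVQ.tendsto_pairDistortion_div_sphereExpression hL two_pos Λ i j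
    rw [pairMoment_three_channels L hij] at h
    exact h
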